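/- All graphs are finite and simple. For a graph $G$ with diagonal degree matrix $D(G)$ and adjacency matrix $A(G)$ and for $\sigma\in[0,1]$, let $A_\sigma(G)=\sigma D(G)+(1-\sigma)A(G)$, and let $\lambda_\sigma(G)$ be its largest eigenvalue. Let $\mathcal{G}_{n,\alpha}$ be the family of connected graphs on $n$ vertices with independence number $\alpha$; an $A_\sigma$-minimizer in $\mathcal{G}_{n,\alpha}$ is a graph in $\mathcal{G}_{n,\alpha}$ whose $\lambda_\sigma$ is smallest possible. For a tree $T$, let $S(T)$ be the graph obtained by subdividing every edge of $T$ once, and for $V(T)=\{v_1,\dots,v_k\}$ and non-negative integers $\ell_1,\dots,\ell_k$ let $S(T)\circ_{V(T)}(\ell_1,\dots,\ell_k)$ be obtained from $S(T)$ by attaching $\ell_i$ pendant edges to $v_i$ for each $i$ (only the original vertices of $T$ receive pendant edges). Let $K_{1,3}$ have leaves $w_1,w_2,w_3$ and centre $w_4$, and let $P_4=u_1u_2u_3u_4$. **Theorem 5.1.** Let $n\ge 12$ and $\sigma\in[\tfrac12,1)$, put $t=\lfloor (n-7)/4\rfloor$ and $\ell'=(n-7)-4t\in\{0,1,2,3\}$,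 and let $\hat T$ be an $A_\sigma$-minimizer in $\mathcal{G}_{n,n-4}$. Then there are non-negative integers $\ell_1,\ell_2,\ell_3,\ell_4$ with $\ell_1+\ell_2+\ell_3+\ell_4=n-7$ such that (a) $\hat T\cong S(K_{1,3})\circ_{V(K_{1,3})}(\ell_1,\ell_2,\ell_3,\ell_4)$, where $\ell_i$ pendant edges are attached to $w_i$, or (b) $\hat T\cong S(P_4)\circ_{V(P_4)}(\ell_1,\ell_2,\ell_3,\ell_4)$, where $\ell_i$ pendant edges are attached to $u_i$; moreover $(\ell_1,\ell_2,\ell_3,\ell_4)$ is one of the following (Table 1). In case (a): - $\ell'=0$: $(t-1,t+1,t+1,t-1)$, $(t,t+1,t+1,t-2)$, $(t,t,t+1,t-1)$, $(t+1,t+1,t+1,t-3)$; - $\ell'=1$: $(t,t+1,t+1,t-1)$, $(t+1,t+1,t+1,t-2)$; - $\ell'=2$: $(t+1,t+1,t+1,t-1)$; - $\ell'=3$: $(t-1,t+2,t+2,t)$, $(t,t+2,t+2,t-1)$, $(t,t+1,t+2,t)$, $(t+1,t+2,t+2,t-2)$, $(t+1,t+1,t+2,t-1)$, $(t+1,t+1,t+1,t)$,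 $(t+2,t+2,t+2,t-3)$. In case (b): - $\ell'=0$: $(t-1,t,t,t+1)$, $(t,t-1,t,t+1)$, $(t,t,t-1,t+1)$, $(t,t,t,t)$, $(t+1,t-2,t,t+1)$, $(t+1,t-1,t-1,t+1)$; - $\ell'=1$: $(t,t,t,t+1)$, $(t+1,t-1,t,t+1)$; - $\ell'=2$: $(t+1,t,t,t+1)$; - $\ell'=3$: $(t-1,t+1,t+1,t+2)$, $(t,t,t+1,t+2)$, $(t,t+1,t,t+2)$, $(t,t+1,t+1,t+1)$, $(t+1,t+1,t-1,t+2)$, $(t+1,t-1,t+1,t+2)$, $(t+1,t,t,t+2)$, $(t+1,t,t+1,t+1)$, $(t+2,t-2,t+1,t+2)$, $(t+2,t-1,t,t+2)$. -/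

import Mathlib

open Classical in
/-- The matrix `A_σ(G) = σ D(G) + (1 - σ) A(G)`, where `D(G)` is the diagonal matrix of vertex
degrees and `A(G)` is the adjacency matrix. -/
noncomputable def aSigmaMatrix {V : Type*} [Fintype V] (σ : ℝ) (G : SimpleGraph V) :
    Matrix V V ℝ :=
  σ • G.degMatrix ℝ + (1 - σ) • G.adjMatrix ℝ

open Classical in
/-- The `A_σ` spectral radius `λ_σ(G)`: the largest (real) eigenvalue of the real symmetric matrix
`A_σ(G)`. -/
noncomputable def aSigmaIndex {V : Type*} [Fintype V] (σ : ℝ) (G : SimpleGraph V) : ℝ :=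
  sSup {μ : ℝ | Module.End.HasEigenvalue (Matrix.toLin' (aSigmaMatrix σ G)) μ}

/-- The family of connected graphs on the vertex set `V` with independence number `α`.
For `Fintype.card V = n` this is `𝒢_{n,α}`, up to isomorphism. -/
def connectedWithIndepNum (V : Type*) (α : ℕ) : Set (SimpleGraph V) :=
  {G | G.Connected ∧ G.indepNum = α}

/-- `G` is an `A_σ`-minimizer among the connected graphs on its vertex set with independence
number `α`. -/
def IsASigmaMinimizer {V : Type*} [Fintype V] (σ : ℝ) (α : ℕ) (G : SimpleGraph V) : Prop :=
  G ∈ connectedWithIndepNum V α ∧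
    ∀ H ∈ connectedWithIndepNum V α, aSigmaIndex σ G ≤ aSigmaIndex σ H

/-- The subdivision graph `S(G)`: every edge `e = xy` of `G` is replaced by a path `x - e - y`,
so the vertices are the original vertices together with one new vertex per edge. -/
def subdivisionGraph {V : Type*} (G : SimpleGraph V) : SimpleGraph (V ⊕ G.edgeSet) where
  Adj
    | .inl v, .inr e => v ∈ (e : Sym2 V)
    | .inr e, .inl v => v ∈ (e : Sym2 V)
    | _, _ => False
  symm := ⟨by rintro (v | e) (w | f) h <;> exact h⟩
  loopless := ⟨by rintro (v | e) h <;> exact h⟩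

/-- Attach `ℓ y` pendant edges (with new end vertices) to the vertex `root y` of `G`, for every
`y`. For an injective `root` with range `Y` this is the graph `G ∘_Y (ℓ)`. -/
def attachPendants {V ι : Type*} (G : SimpleGraph V) (root : ι → V) (ℓ : ι → ℕ) :
    SimpleGraph (V ⊕ (Σ y : ι, Fin (ℓ y))) where
  Adj
    | .inl u, .inl v => G.Adj u v
    | .inl u, .inr p => u = root p.1
    | .inr p, .inl u => u = root p.1
    | .inr _, .inr _ => False
  symm := ⟨by
    rintro (u | p) (v | q) h
    · exact G.adj_symm h
    · exact h
    · exact h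
    · exact h⟩
  loopless := ⟨by
    rintro (u | p) h
    · exact G.loopless.irrefl u h
    · exact h⟩

/-- `S(T) ∘_{V(T)} (ℓ)`: attach `ℓ v` pendant edges to each original vertex `v` of the subdivision
graph of `T`. -/
def subdivisionWithPendants {V : Type*} (T : SimpleGraph V) (ℓ : V → ℕ) :
    SimpleGraph ((V ⊕ T.edgeSet) ⊕ (Σ v : V, Fin (ℓ v))) :=
  attachPendants (subdivisionGraph T) Sum.inl ℓ

/-- The tree `K_{1,3}` on `w₁, w₂, w₃, w₄` (the elements `0, 1, 2, 3` of `Fin 4`), with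
centre `w₄`. -/
def starK13 : SimpleGraph (Fin 4) := SimpleGraph.starGraph 3

/-- The admissible distributions `(ℓ(w₁), ℓ(w₂), ℓ(w₃), ℓ(w₄))` of pendant edges on `S(K_{1,3})`,
in terms of `t = ⌊(n-7)/4⌋` and the residue `ℓ' = (n-7) - 4t`. -/
def starTable (t : ℤ) : ℕ → Set (Fin 4 → ℤ)
  | 0 => {![t - 1, t + 1, t + 1, t - 1],
          ![t, t + 1, t + 1, t - 2],
          ![t, t, t + 1, t - 1],
          ![t + 1, t + 1, t + 1, t - 3]}
  | 1 => {![t, t + 1, t + 1, t - 1],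
          ![t + 1, t + 1, t + 1, t - 2]}
  | 2 => {![t + 1, t + 1, t + 1, t - 1]}
  | 3 => {![t - 1, t + 2, t + 2, t],
          ![t, t + 2, t + 2, t - 1],
          ![t, t + 1, t + 2, t],
          ![t + 1, t + 2, t + 2, t - 2],
          ![t + 1, t + 1, t + 2, t - 1],
          ![t + 1, t + 1, t + 1, t],
          ![t + 2, t + 2, t + 2, t - 3]}
  | _ => ∅

/-- The admissible distributions `(ℓ(u₁), ℓ(u₂), ℓ(u₃), ℓ(u₄))` of pendant edges on `S(P₄)`, where
`P₄ = u₁u₂u₃u₄`, in terms of `t = ⌊(n-7)/4⌋` and the residue `ℓ' = (n-7) - 4t`. -/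
def pathTable (t : ℤ) : ℕ → Set (Fin 4 → ℤ)
  | 0 => {![t - 1, t, t, t + 1],
          ![t, t - 1, t, t + 1],
          ![t, t, t - 1, t + 1],
          ![t, t, t, t],
          ![t + 1, t - 2, t, t + 1],
          ![t + 1, t - 1, t - 1, t + 1]}
  | 1 => {![t, t, t, t + 1],
          ![t + 1, t - 1, t, t + 1]}
  | 2 => {![t + 1, t, t, t + 1]}
  | 3 => {![t - 1, t + 1, t + 1, t + 2],
          ![t, t, t + 1, t + 2],
          ![t, t + 1, t, t + 2],
          ![t, t + 1, t + 1, t + 1],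
          ![t + 1, t + 1, t - 1, t + 2],
          ![t + 1, t - 1, t + 1, t + 2],
          ![t + 1, t, t, t + 2],
          ![t + 1, t, t + 1, t + 1],
          ![t + 2, t - 2, t + 1, t + 2],
          ![t + 2, t - 1, t, t + 2]}
  | _ => ∅

/-! Put D = ⌊(n+2)/4⌋ and let μ be the larger root of (μ - Dσ)(μ - 2σ) = 2D(1-σ)², the index of
(D,2)-semiregular bipartite graphs. A vertex of degree above D forces λ_σ ≥ μ, by comparison with a
star and because σ ≥ 1/2 (`semiregular_le_of_lt_degree`), whereas a suitably loaded S(P₄) stays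
strictly below μ (`aSigmaIndex_lt_semiregular`, `exists_balanced_graph`). Hence a minimizer T has
maximum degree at most D.

The complement C of a maximum independent set of T is a cover by four vertices. A connected graph
covered by C whose independence number exceeds n-4 has a cover by three vertices, hence a vertex of
degree above D; so T is minimal among all connected graphs covered by C. Comparison with a spanning
tree shows that T is a tree. Undoing a Kelmans operation at a leaf lowers λ_σ
(`exists_connected_lt_of_leaf`); together with counts of leaves this makes C independent and bounds
the degrees outside C by two. So T is a subdivided four-vertex tree with pendant edges at C
(`exists_iso_subdivisionWithPendants`).

The four core degrees sum to n-1 and are at most D. The total slack 4D-(n-1) is at most 3, and its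
distributions, up to automorphisms of K_{1,3} and P₄, are the rows of the table. -/

/-! ### Rayleigh quotients and Perron–Frobenius for A_σ. -/

section Spectral

variable {V : Type*} [Fintype V] {σ : ℝ} {G H : SimpleGraph V}

open Classical in
/-- The entries of the vector `A_σ(G) x`, written as sums over neighbours. -/
noncomputable def aSigmaAction (σ : ℝ) (G : SimpleGraph V) (x : V → ℝ) (i : V) : ℝ :=
  ∑ j, if G.Adj i j then σ * x i + (1 - σ) * x j else 0

open Classical in
theorem aSigmaMatrix_mulVec (σ : ℝ) (G : SimpleGraph V) (x : V → ℝ) :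
    Matrix.mulVec (aSigmaMatrix σ G) x = aSigmaAction σ G x := by
  ext i
  have h1 : (∑ j, if G.Adj i j then σ * x i else 0) = σ * (G.degree i * x i) := by
    rw [← Finset.sum_filter, Finset.sum_const, ← SimpleGraph.neighborFinset_eq_filter,
      SimpleGraph.card_neighborFinset_eq_degree, nsmul_eq_mul]
    ring
  have h2 : (∑ j, if G.Adj i j then (1 - σ) * x j else 0) =
      (1 - σ) * ∑ j, (if G.Adj i j then x j else 0) := by
    rw [Finset.mul_sum]
    exact Finset.sum_congr rfl fun j _ => by split_ifs <;> simp
  have h3 : aSigmaAction σ G x i = (∑ j, if G.Adj i j then σ * x i else 0) +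
      ∑ j, if G.Adj i j then (1 - σ) * x j else 0 := by
    rw [aSigmaAction, ← Finset.sum_add_distrib]
    exact Finset.sum_congr rfl fun j _ => by split_ifs <;> simp
  rw [h3, h1, h2, aSigmaMatrix, Matrix.add_mulVec, Matrix.smul_mulVec, Matrix.smul_mulVec,
    Pi.add_apply, Pi.smul_apply, Pi.smul_apply, SimpleGraph.degMatrix, Matrix.mulVec_diagonal,
    SimpleGraph.adjMatrix_mulVec_apply, SimpleGraph.neighborFinset_eq_filter, Finset.sum_filter]
  simp

open Classical in
theorem aSigmaMatrix_isHermitian (σ : ℝ) (G : SimpleGraph V) : (aSigmaMatrix σ G).IsHermitian := by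
  rw [Matrix.IsHermitian, Matrix.conjTranspose_eq_transpose_of_trivial, aSigmaMatrix,
    Matrix.transpose_add, Matrix.transpose_smul, Matrix.transpose_smul,
    SimpleGraph.transpose_adjMatrix, SimpleGraph.degMatrix, Matrix.diagonal_transpose]

open Classical in
theorem hasEigenvalue_aSigmaMatrix {μ : ℝ} {x : V → ℝ} (hx : x ≠ 0)
    (h : aSigmaAction σ G x = μ • x) :
    Module.End.HasEigenvalue (Matrix.toLin' (aSigmaMatrix σ G)) μ := by
  refine Module.End.hasEigenvalue_of_hasEigenvector (x := x) ⟨?_, hx⟩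
  rw [Module.End.mem_eigenspace_iff, Matrix.toLin'_apply, aSigmaMatrix_mulVec, h]

-- The spectrum is finite, and nonempty by the spectral theorem, so the supremum in `aSigmaIndex` is
-- attained and is not a default value of `sSup`.
open Classical in
theorem aSigmaIndex_isGreatest [Nonempty V] (σ : ℝ) (G : SimpleGraph V) :
    IsGreatest {μ : ℝ | Module.End.HasEigenvalue (Matrix.toLin' (aSigmaMatrix σ G)) μ}
      (aSigmaIndex σ G) := by
  have hfin := Module.End.finite_hasEigenvalue (Matrix.toLin' (aSigmaMatrix σ G))
  have hA := aSigmaMatrix_isHermitian σ G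
  have hne : {μ : ℝ | Module.End.HasEigenvalue
      (Matrix.toLin' (aSigmaMatrix σ G)) μ}.Nonempty := by
    obtain ⟨i⟩ := ‹Nonempty V›
    refine ⟨hA.eigenvalues i, hasEigenvalue_aSigmaMatrix
      (x := (hA.eigenvectorBasis i).ofLp) ?_ ?_⟩
    · intro h
      exact hA.eigenvectorBasis.toBasis.ne_zero i (by ext j; simpa using congrFun h j)
    · rw [← aSigmaMatrix_mulVec, hA.mulVec_eigenvectorBasis]
  exact ⟨hne.csSup_mem hfin, fun μ hμ => le_csSup hfin.bddAbove hμ⟩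

-- If ν is an eigenvalue of λI - A, then λ - ν is an eigenvalue of A, so ν ≥ 0 by maximality of λ.
open Classical in
theorem posSemidef_aSigmaIndex_sub (σ : ℝ) (G : SimpleGraph V) :
    (aSigmaIndex σ G • (1 : Matrix V V ℝ) - aSigmaMatrix σ G).PosSemidef := by
  have hB : (aSigmaIndex σ G • (1 : Matrix V V ℝ) - aSigmaMatrix σ G).IsHermitian := by
    refine Matrix.IsHermitian.sub ?_ (aSigmaMatrix_isHermitian σ G)
    rw [Matrix.IsHermitian, Matrix.conjTranspose_eq_transpose_of_trivial, Matrix.transpose_smul,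
      Matrix.transpose_one]
  rw [hB.posSemidef_iff_eigenvalues_nonneg]
  intro i
  have : Nonempty V := ⟨i⟩
  have h := hB.mulVec_eigenvectorBasis i
  set x := (hB.eigenvectorBasis i).ofLp with hx
  have hx0 : x ≠ 0 := by
    intro h
    exact hB.eigenvectorBasis.toBasis.ne_zero i (by ext j; simpa [hx] using congrFun h j)
  rw [Matrix.sub_mulVec, Matrix.smul_mulVec, Matrix.one_mulVec, aSigmaMatrix_mulVec] at h
  have hev : aSigmaAction σ G x = (aSigmaIndex σ G - hB.eigenvalues i) • x := by
    rw [sub_smul, ← h]; abel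
  have := (aSigmaIndex_isGreatest σ G).2 (hasEigenvalue_aSigmaMatrix hx0 hev)
  simpa using this

theorem dotProduct_aSigmaAction_le (σ : ℝ) (G : SimpleGraph V) (x : V → ℝ) :
    x ⬝ᵥ aSigmaAction σ G x ≤ aSigmaIndex σ G * (x ⬝ᵥ x) := by
  classical
  have h := (posSemidef_aSigmaIndex_sub σ G).dotProduct_mulVec_nonneg x
  rw [Matrix.sub_mulVec, Matrix.smul_mulVec, Matrix.one_mulVec, aSigmaMatrix_mulVec,
    dotProduct_sub, dotProduct_smul, star_trivial, smul_eq_mul] at h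
  linarith

/-- A positive semidefinite form vanishes only on its kernel, so a maximizer of the Rayleigh
quotient is an eigenvector. -/
theorem aSigmaAction_eq_of_le_dotProduct {x : V → ℝ}
    (h : aSigmaIndex σ G * (x ⬝ᵥ x) ≤ x ⬝ᵥ aSigmaAction σ G x) :
    aSigmaAction σ G x = aSigmaIndex σ G • x := by
  classical
  have h' := (posSemidef_aSigmaIndex_sub σ G).dotProduct_mulVec_zero_iff x
  rw [Matrix.sub_mulVec, Matrix.smul_mulVec, Matrix.one_mulVec, aSigmaMatrix_mulVec,
    dotProduct_sub, dotProduct_smul, star_trivial, smul_eq_mul] at h'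
  have := h'.1 (by linarith [dotProduct_aSigmaAction_le σ G x])
  rw [sub_eq_zero] at this
  exact this.symm

/-- A test vector with Rayleigh quotient at least `μ` that is not an eigenvector for `μ` shows
`μ < λ_σ(G)`. -/
theorem lt_aSigmaIndex_of_dotProduct {μ : ℝ} {x : V → ℝ}
    (h : μ * (x ⬝ᵥ x) ≤ x ⬝ᵥ aSigmaAction σ G x) {i : V} (hi : aSigmaAction σ G x i ≠ μ * x i) :
    μ < aSigmaIndex σ G := by
  by_contra! hle
  have hxx : 0 ≤ x ⬝ᵥ x := Finset.sum_nonneg fun j _ => mul_self_nonneg (x j)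
  have he := aSigmaAction_eq_of_le_dotProduct ((mul_le_mul_of_nonneg_right hle hxx).trans h)
  rcases hle.eq_or_lt with heq | hlt
  · exact hi (by rw [he, heq]; rfl)
  · rw [he, dotProduct_smul, smul_eq_mul] at h
    have h0 : x ⬝ᵥ x = 0 := by
      by_contra hne
      have := mul_lt_mul_of_pos_right hlt (lt_of_le_of_ne hxx (Ne.symm hne))
      linarith
    have hx0 : x = 0 := dotProduct_self_eq_zero.1 h0
    exact hi (by rw [he, hx0]; simp)

theorem dotProduct_aSigmaAction_comm (σ : ℝ) (G : SimpleGraph V) (x y : V → ℝ) :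
    x ⬝ᵥ aSigmaAction σ G y = aSigmaAction σ G x ⬝ᵥ y := by
  classical
  rw [← aSigmaMatrix_mulVec, ← aSigmaMatrix_mulVec, Matrix.dotProduct_mulVec,
    ← Matrix.mulVec_transpose, ← Matrix.conjTranspose_eq_transpose_of_trivial,
    (aSigmaMatrix_isHermitian σ G).eq]

/-- Perron–Frobenius for `A_σ` of a connected graph. -/
theorem exists_pos_eigenvector (hσ0 : 0 ≤ σ) (hσ1 : σ < 1) (hG : G.Connected) :
    ∃ x : V → ℝ, (∀ i, 0 < x i) ∧ aSigmaAction σ G x = aSigmaIndex σ G • x := by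
  classical
  have := hG.nonempty
  obtain ⟨x, hx, hx0⟩ := (aSigmaIndex_isGreatest σ G).1.exists_hasEigenvector
  rw [Module.End.mem_eigenspace_iff, Matrix.toLin'_apply, aSigmaMatrix_mulVec] at hx
  -- Off-diagonal entries are nonnegative, so taking absolute values does not lower the quadratic
  -- form: |x| is again a maximizer, hence an eigenvector.
  have habs : aSigmaIndex σ G * ((fun i => |x i|) ⬝ᵥ (fun i => |x i|)) ≤
      (fun i => |x i|) ⬝ᵥ aSigmaAction σ G (fun i => |x i|) := by
    have h1 : (fun i => |x i|) ⬝ᵥ (fun i => |x i|) = x ⬝ᵥ x :=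
      Finset.sum_congr rfl fun i _ => abs_mul_abs_self (x i)
    have h2 : x ⬝ᵥ aSigmaAction σ G x = aSigmaIndex σ G * (x ⬝ᵥ x) := by
      rw [hx, dotProduct_smul, smul_eq_mul]
    rw [h1, ← h2]
    refine Finset.sum_le_sum fun i _ => ?_
    simp only [aSigmaAction, Finset.mul_sum]
    refine Finset.sum_le_sum fun j _ => ?_
    split_ifs
    · have e1 : x i * x j ≤ |x i| * |x j| := (le_abs_self _).trans (abs_mul _ _).le
      have e2 := abs_mul_abs_self (x i)
      nlinarith
    · simp
  have he := aSigmaAction_eq_of_le_dotProduct habs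
  refine ⟨fun i => |x i|, ?_, he⟩
  by_contra! hneg
  obtain ⟨i, hi⟩ := hneg
  replace hi : x i = 0 := by simpa using hi
  -- At a zero of |x| the eigenvalue equation is a vanishing sum of nonnegative terms, so zeros
  -- spread along edges.
  have hstep : ∀ a b, G.Adj a b → x a = 0 → x b = 0 := by
    intro a b hab ha
    have h := congrFun he a
    rw [aSigmaAction, Pi.smul_apply] at h
    simp only [ha, abs_zero, mul_zero, smul_zero, zero_add] at h
    rw [Finset.sum_eq_zero_iff_of_nonneg] at h
    · have := h b (Finset.mem_univ b)
      rw [if_pos hab] at this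
      rcases mul_eq_zero.1 this with h' | h'
      · linarith
      · exact abs_eq_zero.1 h'
    · intro j _
      split_ifs
      · exact mul_nonneg (by linarith) (abs_nonneg _)
      · exact le_rfl
  have hall : ∀ j, x j = 0 := by
    intro j
    obtain ⟨w⟩ := hG.preconnected i j
    induction w with
    | nil => exact hi
    | cons hadj _ ih => exact ih (hstep _ _ hadj hi)
  exact hx0 (funext hall)

/-- A positive supersolution that is strict somewhere bounds `λ_σ` strictly from above. -/
theorem aSigmaIndex_lt_of_supersolution (hσ0 : 0 ≤ σ) (hσ1 : σ < 1) (hG : G.Connected) {μ : ℝ}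
    {w : V → ℝ} (hw : ∀ i, 0 < w i) (hle : ∀ i, aSigmaAction σ G w i ≤ μ * w i) {i : V}
    (hi : aSigmaAction σ G w i < μ * w i) : aSigmaIndex σ G < μ := by
  obtain ⟨x, hx, hxe⟩ := exists_pos_eigenvector hσ0 hσ1 hG
  -- Pair the supersolution with the Perron vector; symmetry of A_σ turns the left side into λ_σ
  -- times x ⬝ᵥ w.
  have h1 : x ⬝ᵥ aSigmaAction σ G w < μ * (x ⬝ᵥ w) := by
    simp only [dotProduct, Finset.mul_sum]
    refine Finset.sum_lt_sum (fun j _ => ?_) ⟨i, Finset.mem_univ i, ?_⟩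
    · nlinarith [mul_le_mul_of_nonneg_left (hle j) (hx j).le]
    · nlinarith [mul_lt_mul_of_pos_left hi (hx i)]
  rw [dotProduct_aSigmaAction_comm, hxe, smul_dotProduct, smul_eq_mul] at h1
  refine lt_of_mul_lt_mul_right h1 (Finset.sum_nonneg fun j _ => ?_)
  exact (mul_pos (hx j) (hw j)).le

/-- `λ_σ` is strictly monotone in the edge set. -/
theorem aSigmaIndex_lt_of_lt (hσ0 : 0 ≤ σ) (hσ1 : σ < 1) (hG : G.Connected) (hlt : G < H) :
    aSigmaIndex σ G < aSigmaIndex σ H := by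
  classical
  obtain ⟨x, hx, hxe⟩ := exists_pos_eigenvector hσ0 hσ1 hG
  obtain ⟨a, b, hab, hab'⟩ : ∃ a b, H.Adj a b ∧ ¬ G.Adj a b := by
    by_contra! h
    exact hlt.not_ge fun a b => h a b
  have hterm : ∀ i j, (if G.Adj i j then σ * x i + (1 - σ) * x j else 0) ≤
      (if H.Adj i j then σ * x i + (1 - σ) * x j else 0) := by
    intro i j
    have h0 : 0 ≤ σ * x i + (1 - σ) * x j :=
      add_nonneg (mul_nonneg hσ0 (hx i).le) (mul_nonneg (by linarith) (hx j).le)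
    by_cases h : G.Adj i j
    · rw [if_pos h, if_pos (hlt.le h)]
    · rw [if_neg h]
      split_ifs
      · exact h0
      · exact le_rfl
  have hle : ∀ i, aSigmaIndex σ G * x i ≤ aSigmaAction σ H x i := by
    intro i
    have := congrFun hxe i
    rw [Pi.smul_apply, smul_eq_mul] at this
    rw [← this]
    exact Finset.sum_le_sum fun j _ => hterm i j
  refine lt_aSigmaIndex_of_dotProduct (x := x) (i := a) ?_ (ne_of_gt ?_)
  · rw [dotProduct, dotProduct, Finset.mul_sum]
    exact Finset.sum_le_sum fun i _ => by nlinarith [mul_le_mul_of_nonneg_left (hle i) (hx i).le]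
  · have := congrFun hxe a
    rw [Pi.smul_apply, smul_eq_mul] at this
    rw [← this]
    refine Finset.sum_lt_sum (fun j _ => hterm a j) ⟨b, Finset.mem_univ b, ?_⟩
    rw [if_neg hab', if_pos hab]
    exact add_pos_of_nonneg_of_pos (mul_nonneg hσ0 (hx a).le) (mul_pos (by linarith) (hx b))

end Spectral

/-! ### Kelmans' operation and comparison with semiregular bipartite graphs. -/

section Transformations

variable {V : Type*} [Fintype V] {σ : ℝ} {G H : SimpleGraph V}

/-- `H` arises from `G` by moving the private neighbours of `v` to `u` (Kelmans' operation). -/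
structure IsKelmansTransform {V : Type*} (G H : SimpleGraph V) (u v : V) : Prop where
  ne : u ≠ v
  off : ∀ i j, i ≠ u → i ≠ v → j ≠ u → j ≠ v → (H.Adj i j ↔ G.Adj i j)
  edge : H.Adj u v ↔ G.Adj u v
  left : ∀ z, z ≠ u → z ≠ v → (H.Adj u z ↔ G.Adj u z ∨ G.Adj v z)
  right : ∀ z, z ≠ u → z ≠ v → (H.Adj v z ↔ G.Adj u z ∧ G.Adj v z)

-- Let S be the set of private neighbours of `v`. Row `u` gains the terms of S, row `v` loses them,
-- and each vertex of S trades the neighbour `v` for `u`.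
open Classical in
theorem IsKelmansTransform.aSigmaAction_eq {u v : V} (h : IsKelmansTransform G H u v)
    (x : V → ℝ) (i : V) :
    aSigmaAction σ H x i = aSigmaAction σ G x i +
      (if i = u then ∑ j, (if j ≠ u ∧ G.Adj v j ∧ ¬ G.Adj u j then σ * x u + (1 - σ) * x j else 0)
        else 0) -
      (if i = v then ∑ j, (if j ≠ u ∧ G.Adj v j ∧ ¬ G.Adj u j then σ * x v + (1 - σ) * x j else 0)
        else 0) +
      (if i ≠ u ∧ G.Adj v i ∧ ¬ G.Adj u i then (1 - σ) * (x u - x v) else 0) := by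
  obtain ⟨hne, hoff, hedge, hleft, hright⟩ := h
  set S : V → Prop := fun j => j ≠ u ∧ G.Adj v j ∧ ¬ G.Adj u j with hS
  have hterm : ∀ j, (if H.Adj i j then σ * x i + (1 - σ) * x j else 0) =
      (if G.Adj i j then σ * x i + (1 - σ) * x j else 0) +
      (if i = u then (if S j then σ * x u + (1 - σ) * x j else 0) else 0) -
      (if i = v then (if S j then σ * x v + (1 - σ) * x j else 0) else 0) +
      ((if j = u then (if S i then σ * x i + (1 - σ) * x u else 0) else 0) -
      (if j = v then (if S i then σ * x i + (1 - σ) * x v else 0) else 0)) := by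
    intro j
    have hSu : ¬ S u := fun h => h.1 rfl
    have hSv : ¬ S v := fun h => G.loopless.irrefl v h.2.1
    by_cases hiu : i = u
    · subst hiu
      by_cases hju : j = i
      · subst hju
        simp [hSu, hne]
      by_cases hjv : j = v
      · subst hjv
        simp [hSu, hSv, hne, hedge]
      simp only [hleft j hju hjv, hS, hju, hjv, hne]
      by_cases h1 : G.Adj i j <;> by_cases h2 : G.Adj v j <;> simp [h1, h2, hju]
    by_cases hiv : i = v
    · subst hiv
      by_cases hju : j = u
      · subst hju
        simp [hSu, hSv, hiu, H.adj_comm i j, G.adj_comm i j, hedge]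
      by_cases hjv : j = i
      · subst hjv
        simp [hSv, hiu]
      simp only [hright j hju hjv, hS, hju, hjv, hiu]
      by_cases h1 : G.Adj u j <;> by_cases h2 : G.Adj i j <;> simp [h1, h2, hju]
    by_cases hju : j = u
    · subst hju
      simp only [H.adj_comm i j, G.adj_comm i j, hleft i hiu hiv, hS, hiu, hiv, hne]
      by_cases h1 : G.Adj j i <;> by_cases h2 : G.Adj v i <;> simp [h1, h2, hiu]
    by_cases hjv : j = v
    · subst hjv
      simp only [H.adj_comm i j, G.adj_comm i j, hright i hiu hiv, hS, hiu, hiv, hju]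
      by_cases h1 : G.Adj u i <;> by_cases h2 : G.Adj j i <;> simp [h1, h2, hiu]
    simp [hiu, hiv, hju, hjv, hoff i j hiu hiv hju hjv]
  rw [aSigmaAction, Finset.sum_congr rfl fun j _ => hterm j, Finset.sum_add_distrib,
    Finset.sum_sub_distrib, Finset.sum_add_distrib, Finset.sum_sub_distrib,
    Finset.sum_ite_eq', Finset.sum_ite_eq', if_pos (Finset.mem_univ _),
    if_pos (Finset.mem_univ _), aSigmaAction]
  congr 1
  · congr 1
    · congr 1
      split_ifs <;> simp [hS]
    · split_ifs <;> simp [hS]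
  · split_ifs
    · ring
    · simp

open Classical in
theorem IsKelmansTransform.lt_aSigmaIndex_of_le {u v : V} (h : IsKelmansTransform G H u v)
    (hσ0 : 0 ≤ σ) (hσ1 : σ < 1) {μ : ℝ} {x : V → ℝ} (hx : ∀ i, 0 < x i)
    (hxe : aSigmaAction σ G x = μ • x) (hle : x v ≤ x u) {z : V} (hzu : z ≠ u)
    (hvz : G.Adj v z) (huz : ¬ G.Adj u z) : μ < aSigmaIndex σ H := by
  have hσ1' : 0 < 1 - σ := by linarith
  have key := h.aSigmaAction_eq (σ := σ) x
  set Pu := ∑ j, (if j ≠ u ∧ G.Adj v j ∧ ¬ G.Adj u j then σ * x u + (1 - σ) * x j else 0) with hPu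
  set Pv := ∑ j, (if j ≠ u ∧ G.Adj v j ∧ ¬ G.Adj u j then σ * x v + (1 - σ) * x j else 0) with hPv
  have hPvu : Pv ≤ Pu := Finset.sum_le_sum fun j _ => by
    split_ifs
    · nlinarith
    · exact le_rfl
  have hPv0 : 0 < Pv := by
    refine Finset.sum_pos' (fun j _ => ?_) ⟨z, Finset.mem_univ z, ?_⟩
    · split_ifs
      · exact add_nonneg (mul_nonneg hσ0 (hx v).le) (mul_nonneg hσ1'.le (hx j).le)
      · exact le_rfl
    · rw [if_pos ⟨hzu, hvz, huz⟩]
      exact add_pos_of_nonneg_of_pos (mul_nonneg hσ0 (hx v).le) (mul_pos hσ1' (hx z))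
  have hxi : ∀ i, aSigmaAction σ G x i = μ * x i := fun i => by rw [hxe]; rfl
  -- Since `x v ≤ x u`, the quadratic form at x does not decrease, while row `u` grows by `Pu > 0`,
  -- so x is no eigenvector of the new graph for μ.
  refine lt_aSigmaIndex_of_dotProduct (x := x) (i := u) ?_ (ne_of_gt ?_)
  · have hsum : x ⬝ᵥ aSigmaAction σ H x = μ * (x ⬝ᵥ x) + x u * Pu - x v * Pv +
        ∑ i, x i * (if i ≠ u ∧ G.Adj v i ∧ ¬ G.Adj u i then (1 - σ) * (x u - x v) else 0) := by
      simp only [dotProduct, key, hxi, mul_add, mul_sub, Finset.sum_add_distrib,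
        Finset.sum_sub_distrib, mul_ite, mul_zero, Finset.sum_ite_eq', Finset.mem_univ, if_true,
        Finset.mul_sum]
      congr 3
      exact Finset.sum_congr rfl fun i _ => by ring
    have h3 : 0 ≤ ∑ i, x i *
        (if i ≠ u ∧ G.Adj v i ∧ ¬ G.Adj u i then (1 - σ) * (x u - x v) else 0) := by
      refine Finset.sum_nonneg fun i _ => mul_nonneg (hx i).le ?_
      split_ifs
      · exact mul_nonneg hσ1'.le (by linarith)
      · exact le_rfl
    have h4 : x v * Pv ≤ x u * Pu := mul_le_mul hle hPvu hPv0.le (hx u).le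
    rw [hsum]
    linarith
  · rw [key, hxi, if_pos rfl, if_neg h.ne, if_neg (fun h => h.1 rfl)]
    linarith

/-- Kelmans' operation on a connected graph strictly increases `λ_σ` unless it is a relabelling. -/
theorem IsKelmansTransform.aSigmaIndex_lt {u v : V} (h : IsKelmansTransform G H u v)
    (hσ0 : 0 ≤ σ) (hσ1 : σ < 1) (hG : G.Connected)
    (hu : ∃ z, z ≠ v ∧ G.Adj u z ∧ ¬ G.Adj v z) (hv : ∃ z, z ≠ u ∧ G.Adj v z ∧ ¬ G.Adj u z) :
    aSigmaIndex σ G < aSigmaIndex σ H := by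
  classical
  obtain ⟨x, hx, hxe⟩ := exists_pos_eigenvector hσ0 hσ1 hG
  rcases le_total (x v) (x u) with hle | hle
  · obtain ⟨z, hz, h1, h2⟩ := hv
    exact h.lt_aSigmaIndex_of_le hσ0 hσ1 hx hxe hle hz h1 h2
  · obtain ⟨z, hz, h1, h2⟩ := hu
    let e := Equiv.swap u v
    have heu : e u = v := Equiv.swap_apply_left u v
    have hev : e v = u := Equiv.swap_apply_right u v
    have heo : ∀ i, i ≠ u → i ≠ v → e i = i := fun i => Equiv.swap_apply_of_ne_of_ne
    have hzu : z ≠ u := h1.ne'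
    -- Kelmans' operation is symmetric up to relabelling: exchanging `u` and `v` in `G` leads to the
    -- same `H`, which reduces to the case already treated.
    have hK : IsKelmansTransform (G.comap e) H u v := by
      refine ⟨h.ne, fun i j hi hi' hj hj' => ?_, ?_, fun w hw hw' => ?_, fun w hw hw' => ?_⟩
      · simp only [SimpleGraph.comap_adj, heo i hi hi', heo j hj hj', h.off i j hi hi' hj hj']
      · simp only [SimpleGraph.comap_adj, heu, hev, h.edge, G.adj_comm]
      · simp only [SimpleGraph.comap_adj, heu, hev, heo w hw hw', h.left w hw hw', or_comm]
      · simp only [SimpleGraph.comap_adj, heu, hev, heo w hw hw', h.right w hw hw', and_comm]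
    refine hK.lt_aSigmaIndex_of_le (x := x ∘ e) (z := z) hσ0 hσ1 (fun i => hx _) ?_ ?_ hzu ?_ ?_
    · ext i
      have := congrFun hxe (e i)
      simp only [aSigmaAction, Pi.smul_apply, SimpleGraph.comap_adj, Function.comp_apply]
        at this ⊢
      rw [← this]
      exact Equiv.sum_comp e (fun j => if G.Adj (e i) j then σ * x (e i) + (1 - σ) * x j else 0)
    · simpa [heu, hev] using hle
    · simpa [hev, heo z hzu hz] using h1
    · simpa [heu, heo z hzu hz] using h2

open Classical in
/-- A vertex of degree larger than `D` forces `λ_σ` above the index of the `(D, 2)`-semiregular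
bipartite graphs. -/
theorem semiregular_le_of_lt_degree (hσ : 1 / 2 ≤ σ) (hσ1 : σ < 1) (hG : G.Connected) {D : ℕ}
    (hD : 1 ≤ D) {v : V} (hv : D < G.degree v) :
    2 * σ < aSigmaIndex σ G ∧
      2 * D * (1 - σ) ^ 2 ≤ (aSigmaIndex σ G - D * σ) * (aSigmaIndex σ G - 2 * σ) := by
  obtain ⟨x, hx, hxe⟩ := exists_pos_eigenvector (by linarith) hσ1 hG
  set L := aSigmaIndex σ G
  have hterm : ∀ i j, 0 ≤ if G.Adj i j then σ * x i + (1 - σ) * x j else 0 := by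
    intro i j
    split_ifs
    · exact add_nonneg (mul_nonneg (by linarith) (hx i).le) (mul_nonneg (by linarith) (hx j).le)
    · exact le_rfl
  have hxi : ∀ i, aSigmaAction σ G x i = L * x i := fun i => by rw [hxe]; rfl
  -- In the eigenvalue equation at `z` only the term of the edge to `v` is kept, as if `z` were a
  -- leaf of a star centred at `v`.
  have hz : ∀ z, G.Adj v z → (1 - σ) * x v ≤ (L - σ) * x z := by
    intro z hvz
    have h1 := Finset.single_le_sum (f := fun j => if G.Adj z j then σ * x z + (1 - σ) * x j else 0)
      (fun j _ => hterm z j) (Finset.mem_univ v)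
    rw [if_pos hvz.symm] at h1
    have h2 : σ * x z + (1 - σ) * x v ≤ L * x z := by rw [← hxi z]; exact h1
    linarith
  obtain ⟨z, hvz⟩ := (G.degree_pos_iff_exists_adj v).1 (by omega)
  have hLσ : 0 < L - σ := by
    by_contra! hneg
    have := hz z hvz
    nlinarith [hx z, hx v, mul_pos (sub_pos.2 hσ1) (hx v)]
  have hd : (D : ℝ) + 1 ≤ G.degree v := by exact_mod_cast hv
  have hmain : (G.degree v : ℝ) * ((σ * (L - σ) + (1 - σ) ^ 2) * x v) ≤ L * (L - σ) * x v := by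
    have h1 : L * (L - σ) * x v = (L - σ) * aSigmaAction σ G x v := by rw [hxi]; ring
    rw [h1, aSigmaAction, Finset.mul_sum, ← SimpleGraph.card_neighborFinset_eq_degree,
      SimpleGraph.neighborFinset_eq_filter, ← nsmul_eq_mul, ← Finset.sum_const,
      Finset.sum_filter]
    refine Finset.sum_le_sum fun j _ => ?_
    split_ifs with hj
    · nlinarith [mul_le_mul_of_nonneg_left (hz j hj) (sub_nonneg.2 hσ1.le)]
    · simp
  have hpos : 0 < σ * (L - σ) + (1 - σ) ^ 2 :=
    add_pos_of_pos_of_nonneg (mul_pos (by linarith) hLσ) (sq_nonneg _)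
  have h2 : ((D : ℝ) + 1) * (σ * (L - σ) + (1 - σ) ^ 2) ≤ L * (L - σ) := by
    refine le_of_mul_le_mul_right (le_trans ?_ hmain) (hx v)
    rw [mul_assoc]
    exact mul_le_mul_of_nonneg_right hd (mul_pos hpos (hx v)).le
  have hD' : (1 : ℝ) ≤ D := by exact_mod_cast hD
  have h3 : 0 < (L - (D + 1) * σ) * (L - σ) := by
    nlinarith [mul_pos (by linarith : (0:ℝ) < D + 1) (pow_pos (sub_pos.2 hσ1) 2)]
  have h4 : 0 < L - (D + 1) * σ := pos_of_mul_pos_left h3 hLσ.le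
  constructor
  · nlinarith
  -- The star bound `h2` exceeds the claim by (D-1)(σ² - (1-σ)²), which is nonnegative because σ ≥
  -- 1/2.
  · nlinarith [mul_nonneg (sub_nonneg.2 hD') (by nlinarith : (0:ℝ) ≤ σ ^ 2 - (1 - σ) ^ 2)]

open Classical in
/-- A bipartite graph with degrees at most `D` on one side and at most `2` on the other, with a
leaf on the other side, has smaller `λ_σ` than the `(D, 2)`-semiregular bipartite graphs. -/
theorem aSigmaIndex_lt_semiregular (hσ0 : 0 < σ) (hσ1 : σ < 1) (hG : G.Connected) {C : Set V}
    (hbip : ∀ i j, G.Adj i j → (i ∈ C ↔ j ∉ C)) {D : ℕ} (hC : ∀ i ∈ C, G.degree i ≤ D)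
    (hI : ∀ i ∉ C, G.degree i ≤ 2) {p : V} (hp : p ∉ C) (hp1 : G.degree p ≤ 1) {μ : ℝ}
    (hμ : 2 * σ < μ) (hμD : 2 * D * (1 - σ) ^ 2 ≤ (μ - D * σ) * (μ - 2 * σ)) :
    aSigmaIndex σ G < μ := by
  have hμ' : 0 < μ - 2 * σ := by linarith
  have hσ1' : 0 < 1 - σ := by linarith
  -- With the value 1 on `C` and y elsewhere, this y makes the equation at an outer vertex of degree
  -- two exact. The inequality on `C` is then `hμD`, and the leaf `p` gives strictness.
  obtain ⟨y, hy⟩ : ∃ y, y * (μ - 2 * σ) = 2 * (1 - σ) := ⟨_, div_mul_cancel₀ _ hμ'.ne'⟩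
  have hy0 : 0 < y := by
    by_contra! h
    nlinarith
  have hdeg : ∀ i (c : ℝ), (∑ j, if G.Adj i j then c else 0) = G.degree i * c := by
    intro i c
    rw [← Finset.sum_filter, Finset.sum_const, ← SimpleGraph.neighborFinset_eq_filter,
      SimpleGraph.card_neighborFinset_eq_degree, nsmul_eq_mul]
  set w : V → ℝ := fun i => if i ∈ C then 1 else y with hw
  have hactC : ∀ i ∈ C, aSigmaAction σ G w i = G.degree i * (σ + (1 - σ) * y) := by
    intro i hi
    rw [← hdeg, aSigmaAction]
    refine Finset.sum_congr rfl fun j _ => ?_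
    split_ifs with h
    · simp [hw, hi, (hbip i j h).1 hi]
    · rfl
  have hactI : ∀ i ∉ C, aSigmaAction σ G w i = G.degree i * (σ * y + (1 - σ)) := by
    intro i hi
    rw [← hdeg, aSigmaAction]
    refine Finset.sum_congr rfl fun j _ => ?_
    split_ifs with h
    · have hj : j ∈ C := by
        by_contra hj
        exact hi ((hbip i j h).2 hj)
      simp [hw, hi, hj]
    · rfl
  refine aSigmaIndex_lt_of_supersolution hσ0.le hσ1 hG (w := w) (i := p) ?_ ?_ ?_
  · intro i
    simp only [hw]
    split_ifs
    · exact one_pos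
    · exact hy0
  · intro i
    by_cases hi : i ∈ C
    · rw [hactC i hi]
      have h1 : (G.degree i : ℝ) ≤ D := by exact_mod_cast hC i hi
      have h2 : (D : ℝ) * (σ + (1 - σ) * y) ≤ μ := by
        refine le_of_mul_le_mul_right ?_ hμ'
        calc (D : ℝ) * (σ + (1 - σ) * y) * (μ - 2 * σ)
            = D * σ * (μ - 2 * σ) + D * (1 - σ) * (y * (μ - 2 * σ)) := by ring
          _ ≤ μ * (μ - 2 * σ) := by rw [hy]; nlinarith
      have h3 : 0 ≤ σ + (1 - σ) * y := by positivity
      have h4 : w i = 1 := if_pos hi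
      rw [h4, mul_one]
      exact (mul_le_mul_of_nonneg_right h1 h3).trans h2
    · rw [hactI i hi]
      have h1 : (G.degree i : ℝ) ≤ 2 := by exact_mod_cast hI i hi
      have h3 : 0 ≤ σ * y + (1 - σ) := by positivity
      have h4 : w i = y := if_neg hi
      rw [h4]
      nlinarith
  · rw [hactI p hp]
    have h1 : (G.degree p : ℝ) ≤ 1 := by exact_mod_cast hp1
    have h3 : 0 ≤ σ * y + (1 - σ) := by positivity
    have h4 : w p = y := if_neg hp
    rw [h4]
    nlinarith [mul_pos hσ0 hy0]

end Transformations

/-! ### Vertex covers, edge counts and the leaf move. -/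

section Covers

variable {V : Type*} [Fintype V] {G T : SimpleGraph V} {C : Finset V}

-- The complement of a cover is independent, so its vertices have disjoint incidence sets.
open Classical in
theorem sum_degree_compl_eq_card (hC : ∀ i j, G.Adj i j → i ∈ C ∨ j ∈ C) :
    ∑ i ∈ Cᶜ, G.degree i = (Cᶜ.biUnion fun i => G.incidenceFinset i).card := by
  rw [Finset.card_biUnion]
  · simp
  · intro i hi j hj hij
    rw [Function.onFun, Finset.disjoint_left]
    intro e he he'
    rw [SimpleGraph.mem_incidenceFinset] at he he'
    have := G.adj_of_mem_incidenceSet hij he he'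
    rw [Finset.mem_coe, Finset.mem_compl] at hi hj
    exact (hC i j this).elim hi hj

open Classical in
theorem sum_degree_compl_le (hC : ∀ i j, G.Adj i j → i ∈ C ∨ j ∈ C) :
    ∑ i ∈ Cᶜ, G.degree i ≤ G.edgeFinset.card := by
  rw [sum_degree_compl_eq_card hC]
  refine Finset.card_le_card (Finset.biUnion_subset.2 fun i _ => G.incidenceFinset_subset i)

open Classical in
theorem sum_degree_compl_lt (hC : ∀ i j, G.Adj i j → i ∈ C ∨ j ∈ C) {u v : V} (hu : u ∈ C)
    (hv : v ∈ C) (huv : G.Adj u v) : ∑ i ∈ Cᶜ, G.degree i < G.edgeFinset.card := by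
  rw [sum_degree_compl_eq_card hC]
  refine Finset.card_lt_card ((Finset.ssubset_iff_of_subset
    (Finset.biUnion_subset.2 fun i _ => G.incidenceFinset_subset i)).2 ⟨s(u, v), by simpa, ?_⟩)
  simp only [Finset.mem_biUnion, Finset.mem_compl, SimpleGraph.mem_incidenceFinset, not_exists,
    not_and]
  intro i hi h
  rcases Sym2.mem_iff.1 h.2 with rfl | rfl
  · exact hi hu
  · exact hi hv

open Classical in
theorem sum_degree_compl_eq (hC : ∀ i j, G.Adj i j → i ∈ C ∨ j ∈ C)
    (hCC : ∀ i ∈ C, ∀ j ∈ C, ¬ G.Adj i j) : ∑ i ∈ Cᶜ, G.degree i = G.edgeFinset.card := by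
  rw [sum_degree_compl_eq_card hC]
  congr 1
  refine Finset.Subset.antisymm
    (Finset.biUnion_subset.2 fun i _ => G.incidenceFinset_subset i) fun e he => ?_
  induction e with
  | _ a b =>
    have hab : G.Adj a b := by simpa using he
    simp only [Finset.mem_biUnion, Finset.mem_compl, SimpleGraph.mem_incidenceFinset]
    by_cases ha : a ∈ C
    · exact ⟨b, fun hb => hCC a ha b hb hab, hab, Sym2.mem_mk_right a b⟩
    · exact ⟨a, ha, hab, Sym2.mem_mk_left a b⟩

open Classical in
theorem sum_degree_add_sum_degree_compl (G : SimpleGraph V) (C : Finset V) :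
    ∑ i ∈ C, G.degree i + ∑ i ∈ Cᶜ, G.degree i = 2 * G.edgeFinset.card := by
  rw [Finset.sum_add_sum_compl, G.sum_degrees_eq_twice_card_edges]

open Classical in
theorem card_le_card_edgeFinset_add_one (hG : G.Connected) :
    Fintype.card V ≤ G.edgeFinset.card + 1 := by
  have := hG.card_vert_le_card_edgeSet_add_one
  rwa [Nat.card_eq_fintype_card, Nat.card_eq_fintype_card, ← SimpleGraph.edgeFinset_card] at this

-- The degrees over a cover sum to at least the number of edges, which is at least |V| - 1 by
-- connectedness.
open Classical in
theorem exists_lt_degree_of_cover (hG : G.Connected) (hC : ∀ i j, G.Adj i j → i ∈ C ∨ j ∈ C)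
    {D : ℕ} (hD : C.card * D + 1 < Fintype.card V) : ∃ v ∈ C, D < G.degree v := by
  by_contra! h
  have h1 := Finset.sum_le_card_nsmul C (fun i => G.degree i) D h
  have h2 := sum_degree_add_sum_degree_compl G C
  have h3 := sum_degree_compl_le hC
  have h4 := card_le_card_edgeFinset_add_one hG
  rw [smul_eq_mul] at h1
  omega

/-- Complements of independent sets are covers. -/
theorem exists_cover (G : SimpleGraph V) :
    ∃ C : Finset V, C.card + G.indepNum = Fintype.card V ∧
      ∀ i j, G.Adj i j → i ∈ C ∨ j ∈ C := by
  classical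
  obtain ⟨s, hs⟩ := G.exists_isNIndepSet_indepNum
  refine ⟨sᶜ, ?_, fun i j hij => ?_⟩
  · rw [← hs.card_eq, Finset.card_compl, Nat.sub_add_cancel (Finset.card_le_univ s)]
  · by_contra! h
    simp only [Finset.mem_compl, not_not] at h
    exact hs.isIndepSet h.1 h.2 hij.ne hij

theorem card_le_indepNum_add (hC : ∀ i j, G.Adj i j → i ∈ C ∨ j ∈ C) :
    Fintype.card V ≤ G.indepNum + C.card := by
  classical
  have h : G.IsIndepSet (Cᶜ : Finset V) := by
    intro i hi j hj _ hij
    rw [Finset.mem_coe, Finset.mem_compl] at hi hj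
    exact (hC i j hij).elim hi hj
  have := h.card_le_indepNum
  rw [Finset.card_compl] at this
  omega

open Classical in
theorem exists_lt_degree_of_indepNum {k D : ℕ} (hG : G.Connected)
    (hk : Fintype.card V ≤ G.indepNum + k) (hD : k * D + 1 < Fintype.card V) :
    ∃ v, D < G.degree v := by
  obtain ⟨C, hcard, hC⟩ := exists_cover G
  have h1 : C.card * D ≤ k * D := Nat.mul_le_mul_right D (by omega)
  obtain ⟨v, -, hv⟩ := exists_lt_degree_of_cover hG hC (D := D) (by omega)
  exact ⟨v, hv⟩

theorem mem_of_connected {U : Type*} {G : SimpleGraph U} (hG : G.Connected) (S : Set U) {b : U} (hb : b ∈ S)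
    (hS : ∀ x y, G.Adj x y → x ∈ S → y ∈ S) (y : U) :
    y ∈ S := by
  obtain ⟨w⟩ := hG.preconnected b y
  induction w with
  | nil => exact hb
  | cons hadj _ ih => exact ih (hS _ _ hadj hb)

theorem connected_of_adj_reachable {U W : Type*} {G : SimpleGraph U} {H : SimpleGraph W}
    (hG : G.Connected) (r : U → W) (hr : Function.Surjective r) (h : ∀ x y, G.Adj x y → H.Reachable (r x) (r y)) :
    H.Connected := by
  have hreach : ∀ x y, G.Reachable x y → H.Reachable (r x) (r y) := by
    rintro x y ⟨w⟩
    induction w with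
    | nil => exact SimpleGraph.Reachable.refl _
    | cons hadj _ ih => exact (h _ _ hadj).trans ih
  have : Nonempty W := hG.nonempty.map r
  refine ⟨fun i j => ?_⟩
  obtain ⟨x, rfl⟩ := hr i
  obtain ⟨y, rfl⟩ := hr j
  exact hreach x y (hG.preconnected x y)

/-- Let `p` be a leaf at `b`, where `b` is `w` or a neighbour of `w`. Moving the edge `w a` to
`p a` lowers `λ_σ`, provided `w` has a further neighbour. -/
theorem exists_connected_lt_of_leaf {σ : ℝ} (hσ0 : 0 ≤ σ) (hσ1 : σ < 1) (hT : T.Connected)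
    {p b w a c : V} (hp : ∀ z, T.Adj p z ↔ z = b) (hb : b = w ∨ T.Adj b w) (hpw : p ≠ w)
    (hwa : T.Adj w a) (hab : a ≠ b) (hap : a ≠ p) (hwc : T.Adj w c) (hca : c ≠ a) (hcb : c ≠ b)
    (hcp : c ≠ p) :
    ∃ G : SimpleGraph V, G.Connected ∧ (∀ x y, G.Adj x y → T.Adj x y ∨ x = a ∨ y = a) ∧
      aSigmaIndex σ G < aSigmaIndex σ T := by
  let G : SimpleGraph V :=
    { Adj := fun x y => (T.Adj x y ∧ s(x, y) ≠ s(w, a)) ∨ s(x, y) = s(p, a)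
      symm := ⟨fun x y h => by rwa [T.adj_comm, Sym2.eq_swap]⟩
      loopless := ⟨fun x h => by
        rcases h with h | h
        · exact T.loopless.irrefl x h.1
        · rw [Sym2.eq_iff] at h
          rcases h with ⟨h1, h2⟩ | ⟨h1, h2⟩
          · exact hap (h2.symm.trans h1)
          · exact hap (h1.symm.trans h2)⟩ }
  have hG : ∀ x y, G.Adj x y ↔ (T.Adj x y ∧ s(x, y) ≠ s(w, a)) ∨ s(x, y) = s(p, a) :=
    fun x y => Iff.rfl
  have haw : a ≠ w := hwa.ne'
  have hbp : b ≠ p := ((hp b).2 rfl).ne'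
  have hpG : ∀ z, G.Adj p z ↔ z = b ∨ z = a := by
    intro z
    rw [hG, hp, Sym2.eq_iff, Ne, Sym2.eq_iff]
    constructor
    · rintro (⟨h, -⟩ | ⟨-, h⟩ | ⟨h, -⟩)
      · exact Or.inl h
      · exact Or.inr h
      · exact absurd h hap.symm
    · rintro (h | h)
      · refine Or.inl ⟨h, ?_⟩
        rintro (⟨h1, -⟩ | ⟨h1, -⟩)
        · exact hpw h1
        · exact hap h1.symm
      · exact Or.inr (Or.inl ⟨rfl, h⟩)
  have hwG : ∀ z, z ≠ p → (G.Adj w z ↔ T.Adj w z ∧ z ≠ a) := by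
    intro z hz
    rw [hG, Sym2.eq_iff, Ne, Sym2.eq_iff]
    constructor
    · rintro (⟨h, h'⟩ | ⟨h, -⟩ | ⟨h, -⟩)
      · exact ⟨h, fun hza => h' (Or.inl ⟨rfl, hza⟩)⟩
      · exact absurd h.symm hpw
      · exact absurd h.symm haw
    · rintro ⟨h, h'⟩
      refine Or.inl ⟨h, ?_⟩
      rintro (⟨-, h1⟩ | ⟨h1, -⟩)
      · exact h' h1
      · exact haw h1.symm
  -- Read backwards, the move is a Kelmans operation: it hands the private neighbour `a` of `p` back
  -- to `w`, and `b` is either `w` itself or a common neighbour.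
  have hK : IsKelmansTransform G T w p := by
    refine ⟨hpw.symm, fun i j hiw hip hjw hjp => ?_, ?_, fun z hzw hzp => ?_,
      fun z hzw hzp => ?_⟩
    · rw [hG, Sym2.eq_iff, Ne, Sym2.eq_iff]
      tauto
    · rw [G.adj_comm, hpG, T.adj_comm, hp]
      constructor
      · exact Or.inl
      · rintro (h | h)
        · exact h
        · exact absurd h.symm haw
    · rw [hwG z hzp, hpG]
      constructor
      · intro h
        by_cases hza : z = a
        · exact Or.inr (Or.inr hza)
        · exact Or.inl ⟨h, hza⟩
      · rintro (h | rfl | rfl)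
        · exact h.1
        · exact (hb.resolve_left hzw).symm
        · exact hwa
    · rw [hwG z hzp, hpG, hp]
      constructor
      · rintro rfl
        exact ⟨⟨(hb.resolve_left hzw).symm, hab.symm⟩, Or.inl rfl⟩
      · rintro ⟨⟨-, h⟩, h'⟩
        exact h'.resolve_right h
  -- The deleted edge from `w` to `a` is bypassed through `b` and `p`.
  have hconn : G.Connected := by
    have hwb : G.Reachable w b := by
      rcases hb with rfl | hb
      · exact SimpleGraph.Reachable.refl _
      · exact ((hwG b hbp).2 ⟨hb.symm, hab.symm⟩).reachable
    have hwa' : G.Reachable w a :=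
      (hwb.trans ((hpG b).2 (Or.inl rfl)).reachable.symm).trans ((hpG a).2 (Or.inr rfl)).reachable
    refine connected_of_adj_reachable hT id Function.surjective_id fun x y hxy => ?_
    by_cases h : s(x, y) = s(w, a)
    · rw [Sym2.eq_iff] at h
      rcases h with ⟨rfl, rfl⟩ | ⟨rfl, rfl⟩
      · exact hwa'
      · exact hwa'.symm
    · exact SimpleGraph.Adj.reachable ((hG x y).2 (Or.inl ⟨hxy, h⟩))
  refine ⟨G, hconn, fun x y hxy => ?_, hK.aSigmaIndex_lt hσ0 hσ1 hconn ⟨c, hcp, ?_, ?_⟩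
    ⟨a, haw, (hpG a).2 (Or.inr rfl), ?_⟩⟩
  · rcases (hG x y).1 hxy with h | h
    · exact Or.inl h.1
    · rw [Sym2.eq_iff] at h
      tauto
  · exact (hwG c hcp).2 ⟨hwc, hca⟩
  · rw [hpG]
    tauto
  · rw [hwG a hap]
    tauto

end Covers

/-! ### Local structure of a minimal tree. -/

section Minimizers

variable {V : Type*} [Fintype V] {T : SimpleGraph V} {C : Finset V} {σ : ℝ} {D : ℕ}

open Classical in
/-- The leaves of `T` outside the cover `C`. -/
noncomputable def outerLeaves (T : SimpleGraph V) (C : Finset V) : Finset V :=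
  Cᶜ.filter fun i => T.degree i = 1

open Classical in
theorem mem_outerLeaves {p : V} : p ∈ outerLeaves T C ↔ p ∉ C ∧ T.degree p = 1 := by
  simp [outerLeaves]

-- An outer vertex that is not a leaf has degree at least two. For a tree with a cover of size four
-- this gives at least n-7 outer leaves.
open Classical in
theorem two_mul_card_compl_le [Nontrivial V] (hT : T.Connected) (C : Finset V) :
    2 * (Cᶜ : Finset V).card ≤ ∑ i ∈ Cᶜ, T.degree i + (outerLeaves T C).card := by
  rw [outerLeaves, Finset.card_filter, ← Finset.sum_add_distrib, mul_comm, ← smul_eq_mul,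
    ← Finset.sum_const]
  refine Finset.sum_le_sum fun i _ => ?_
  have : 0 < T.degree i := hT.preconnected.degree_pos_of_nontrivial i
  split_ifs <;> omega

open Classical in
theorem exists_nbr_of_mem_outerLeaves (hC : ∀ i j, T.Adj i j → i ∈ C ∨ j ∈ C) {p : V}
    (hp : p ∈ outerLeaves T C) : ∃ b ∈ C, ∀ z, T.Adj p z ↔ z = b := by
  rw [mem_outerLeaves] at hp
  obtain ⟨b, hb, hb'⟩ := (T.degree_eq_one_iff_existsUnique_adj).1 hp.2
  exact ⟨b, (hC p b hb).resolve_left hp.1, fun z => ⟨hb' z, by rintro rfl; exact hb⟩⟩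

open Classical in
/-- A core vertex has a neighbour that is not an outer leaf. -/
theorem card_leaves_lt_degree (hT : T.Connected) (hC : ∀ i j, T.Adj i j → i ∈ C ∨ j ∈ C)
    (hcard : 1 < C.card) {b : V} (hb : b ∈ C) :
    ((outerLeaves T C).filter fun p => T.Adj b p).card < T.degree b := by
  rw [← SimpleGraph.card_neighborFinset_eq_degree]
  refine Finset.card_lt_card ((Finset.ssubset_iff_of_subset fun p hp => ?_).2 ?_)
  · simpa using (Finset.mem_filter.1 hp).2
  by_contra! h
  have hleaf : ∀ p, T.Adj b p → p ∈ outerLeaves T C := fun p hp =>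
    (Finset.mem_filter.1 (h p (by simpa using hp))).1
  obtain ⟨c, hc, hcb⟩ := Finset.exists_mem_ne hcard b
  -- If all neighbours of `b` were outer leaves, the star at `b` would be closed under adjacency and
  -- leave no room for a second core vertex.
  have := mem_of_connected hT {x | x = b ∨ T.Adj b x} (Or.inl rfl) (fun x y hxy hx => ?_) c
  · exact (mem_outerLeaves.1 (hleaf c (this.resolve_left hcb))).1 hc
  · rcases hx with rfl | hx
    · exact Or.inr hxy
    · obtain ⟨b', -, hb'⟩ := exists_nbr_of_mem_outerLeaves hC (hleaf x hx)
      have h1 := (hb' b).1 hx.symm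
      have h2 := (hb' y).1 hxy
      exact Or.inl (h2.trans h1.symm)

open Classical in
theorem card_outerLeaves_le (hC : ∀ i j, T.Adj i j → i ∈ C ∨ j ∈ C) :
    (outerLeaves T C).card ≤
      ∑ b ∈ C, ((outerLeaves T C).filter fun p => T.Adj b p).card := by
  refine le_trans (Finset.card_le_card fun p hp => ?_) Finset.card_biUnion_le
  obtain ⟨b, hb, hb'⟩ := exists_nbr_of_mem_outerLeaves hC hp
  exact Finset.mem_biUnion.2 ⟨b, hb, Finset.mem_filter.2 ⟨hp, ((hb' b).2 rfl).symm⟩⟩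

open Classical in
/-- In a minimal tree with a cover of size four, the cover is independent. -/
theorem not_adj_of_minimal (hσ0 : 0 ≤ σ) (hσ1 : σ < 1) (hn : 12 ≤ Fintype.card V)
    (hT : T.IsTree) (hC : ∀ i j, T.Adj i j → i ∈ C ∨ j ∈ C) (hcard : C.card = 4)
    (hD : 4 * D ≤ Fintype.card V + 2) (hdeg : ∀ i, T.degree i ≤ D)
    (hmin : ∀ H : SimpleGraph V, H.Connected → (∀ i j, H.Adj i j → i ∈ C ∨ j ∈ C) →
      aSigmaIndex σ T ≤ aSigmaIndex σ H) : ∀ u ∈ C, ∀ v ∈ C, ¬ T.Adj u v := by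
  -- Otherwise the edge `u v` could be moved to a leaf of `u`, lowering λ_σ; the new edge is still
  -- covered by `v`.
  have key : ∀ u ∈ C, ∀ v ∈ C, T.Adj u v →
      ((outerLeaves T C).filter fun p => T.Adj u p).card = 0 ∨ T.degree u ≤ 2 := by
    intro u hu v hv huv
    by_contra! h
    obtain ⟨p, hp⟩ := Finset.card_pos.1 (Nat.pos_of_ne_zero h.1)
    rw [Finset.mem_filter] at hp
    have hpC := (mem_outerLeaves.1 hp.1).1
    obtain ⟨b, -, hb⟩ := exists_nbr_of_mem_outerLeaves hC hp.1
    obtain rfl := (hb u).1 hp.2.symm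
    obtain ⟨c, hc, hcv⟩ : ∃ c ∈ T.neighborFinset u, c ∉ ({v, p} : Finset V) := by
      refine Finset.exists_mem_notMem_of_card_lt_card ?_
      rw [SimpleGraph.card_neighborFinset_eq_degree]
      exact lt_of_le_of_lt Finset.card_le_two h.2
    simp only [Finset.mem_insert, Finset.mem_singleton, not_or,
      SimpleGraph.mem_neighborFinset] at hc hcv
    obtain ⟨H, hH, hH', hlt⟩ := exists_connected_lt_of_leaf hσ0 hσ1 hT.connected hb
      (Or.inl rfl) hp.2.ne' huv huv.ne' (fun h => hpC (h ▸ hv)) hc hcv.1 hc.ne' hcv.2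
    refine absurd (hmin H hH fun i j hij => ?_) hlt.not_ge
    rcases hH' i j hij with h | rfl | rfl
    · exact hC i j h
    · exact Or.inl hv
    · exact Or.inr hv
  intro u hu v hv huv
  have : Nontrivial V := Fintype.one_lt_card_iff_nontrivial.1 (by omega)
  have h1 := two_mul_card_compl_le hT.connected C
  have h2 := sum_degree_compl_lt hC hu hv huv
  have h3 := hT.card_edgeFinset
  have h4 := sum_degree_add_sum_degree_compl T C
  have h5 := card_outerLeaves_le hC
  have hvu : v ∈ C.erase u := Finset.mem_erase.2 ⟨huv.ne', hv⟩
  have hrest : ((C.erase u).erase v).card = 2 := by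
    rw [Finset.card_erase_of_mem hvu, Finset.card_erase_of_mem hu, hcard]
  have hD0 : T.degree u ≤ D := hdeg u
  have hlt : ∀ b ∈ C, ((outerLeaves T C).filter fun p => T.Adj b p).card < T.degree b :=
    fun b hb => card_leaves_lt_degree hT.connected hC (by omega) hb
  have hu1 := hlt u hu
  have hv1 := hlt v hv
  -- An edge inside `C` forces at least n-6 outer leaves, while `u` and `v` carry at most one each
  -- and the other two core vertices at most D-1 each. In the remaining tight cases `u` and `v` have
  -- degree at most 2, so the core degrees sum to at most 4+2D, below the required n.
  have h6 : ∑ b ∈ (C.erase u).erase v, ((outerLeaves T C).filter fun p => T.Adj b p).card ≤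
      2 * (D - 1) := by
    rw [← hrest, ← smul_eq_mul]
    refine Finset.sum_le_card_nsmul _ _ _ fun b hb => ?_
    have := hlt b (Finset.mem_of_mem_erase (Finset.mem_of_mem_erase hb))
    have := hdeg b
    omega
  have h7 : ∑ b ∈ (C.erase u).erase v, T.degree b ≤ 2 * D := by
    rw [← hrest, ← smul_eq_mul]
    exact Finset.sum_le_card_nsmul _ _ _ fun b _ => hdeg b
  rw [← Finset.add_sum_erase C _ hu, ← Finset.add_sum_erase (C.erase u) _ hvu] at h5
  rw [← Finset.add_sum_erase C _ hu, ← Finset.add_sum_erase (C.erase u) _ hvu] at h4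
  rw [Finset.card_compl] at h1
  have k1 := key u hu v hv huv
  have k2 := key v hv u hu huv.symm
  have := hdeg v
  omega

open Classical in
/-- In a minimal tree with a cover of size four, vertices outside the cover have degree at most
two. -/
theorem degree_le_two_of_minimal (hσ0 : 0 ≤ σ) (hσ1 : σ < 1) (hn : 12 ≤ Fintype.card V)
    (hT : T.IsTree) (hC : ∀ i j, T.Adj i j → i ∈ C ∨ j ∈ C) (hcard : C.card = 4)
    (hD : 4 * D ≤ Fintype.card V + 2) (hdeg : ∀ i, T.degree i ≤ D)
    (hmin : ∀ H : SimpleGraph V, H.Connected → (∀ i j, H.Adj i j → i ∈ C ∨ j ∈ C) →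
      aSigmaIndex σ T ≤ aSigmaIndex σ H) {w : V} (hw : w ∉ C) : T.degree w ≤ 2 := by
  by_contra! h3
  have : Nontrivial V := Fintype.one_lt_card_iff_nontrivial.1 (by omega)
  have hNC : ∀ z ∈ T.neighborFinset w, z ∈ C := fun z hz =>
    (hC w z (by simpa using hz)).resolve_left hw
  have hsub : T.neighborFinset w ⊆ C := hNC
  -- At most one core vertex is not adjacent to `w`. If it carried all outer leaves, then n-7 ≤ D,
  -- impossible for n ≥ 12.
  obtain ⟨p, hp, b, hpb, hbw⟩ : ∃ p ∈ outerLeaves T C, ∃ b, (∀ z, T.Adj p z ↔ z = b) ∧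
      T.Adj w b := by
    by_contra! hno
    have h1 := two_mul_card_compl_le hT.connected C
    have h2 := sum_degree_compl_le hC
    have h4 := hT.card_edgeFinset
    have h5 : (outerLeaves T C).card ≤ (C \ T.neighborFinset w).card * D := by
      refine le_trans (Finset.card_le_card fun p hp => ?_)
        (Finset.card_biUnion_le_card_mul (C \ T.neighborFinset w) (fun b => T.neighborFinset b) D
          fun b _ => by simpa using hdeg b)
      obtain ⟨b, hb, hb'⟩ := exists_nbr_of_mem_outerLeaves hC hp
      refine Finset.mem_biUnion.2 ⟨b, Finset.mem_sdiff.2 ⟨hb, ?_⟩, ?_⟩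
      · simpa using hno p hp b hb'
      · simpa using ((hb' b).2 rfl).symm
    have h6 : (C \ T.neighborFinset w).card ≤ 1 := by
      rw [Finset.card_sdiff_of_subset hsub, SimpleGraph.card_neighborFinset_eq_degree]
      omega
    have h7 := Nat.mul_le_mul_right D h6
    rw [Finset.card_compl] at h1
    omega
  have hpC := (mem_outerLeaves.1 hp).1
  have hb : b ∈ T.neighborFinset w := by simpa using hbw
  obtain ⟨a, ha, c, hc, hac⟩ : ∃ a ∈ (T.neighborFinset w).erase b,
      ∃ c ∈ (T.neighborFinset w).erase b, a ≠ c := by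
    refine Finset.one_lt_card.1 ?_
    rw [Finset.card_erase_of_mem hb, SimpleGraph.card_neighborFinset_eq_degree]
    omega
  rw [Finset.mem_erase] at ha hc
  have haC := hNC a ha.2
  have hcC := hNC c hc.2
  rw [SimpleGraph.mem_neighborFinset] at ha hc
  have hpw : p ≠ w := by
    rintro rfl
    have := (mem_outerLeaves.1 hp).2
    omega
  -- Moving the edge `w a` to `p a` keeps the cover, since `a` lies in `C`.
  obtain ⟨H, hH, hH', hlt⟩ := exists_connected_lt_of_leaf hσ0 hσ1 hT.connected hpb
    (Or.inr hbw.symm) hpw ha.2 ha.1 (fun h => hpC (h ▸ haC)) hc.2 hac.symm hc.1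
    (fun h => hpC (h ▸ hcC))
  refine absurd (hmin H hH fun i j hij => ?_) hlt.not_ge
  rcases hH' i j hij with h | rfl | rfl
  · exact hC i j h
  · exact Or.inl haC
  · exact Or.inr haC

end Minimizers

/-! ### Connectedness, relabelling and degrees of S(T) with pendant edges. -/

section Subdivision

variable {U : Type*} {S : SimpleGraph U}

theorem subdivisionWithPendants_connected (hS : S.Connected) (ℓ : U → ℕ) :
    (subdivisionWithPendants S ℓ).Connected := by
  have hedge : ∀ (v : U) (e : S.edgeSet), v ∈ (e : Sym2 U) →
      (subdivisionWithPendants S ℓ).Adj (.inl (.inl v)) (.inl (.inr e)) := fun v e h => h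
  have hcore : ∀ v w, (subdivisionWithPendants S ℓ).Reachable (.inl (.inl v)) (.inl (.inl w)) := by
    intro v w
    obtain ⟨p⟩ := hS.preconnected v w
    induction p with
    | nil => exact SimpleGraph.Reachable.refl _
    | @cons a b _ hab _ ih =>
      exact ((hedge a ⟨s(a, b), hab⟩ (Sym2.mem_mk_left a b)).reachable.trans
        (hedge b ⟨s(a, b), hab⟩ (Sym2.mem_mk_right a b)).reachable.symm).trans ih
  have hall : ∀ x, ∃ v, (subdivisionWithPendants S ℓ).Reachable x (.inl (.inl v)) := by
    rintro ((v | ⟨e, he⟩) | p)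
    · exact ⟨v, SimpleGraph.Reachable.refl _⟩
    · induction e with
      | _ a b => exact ⟨a, (hedge a ⟨s(a, b), he⟩ (Sym2.mem_mk_left a b)).reachable.symm⟩
    · refine ⟨p.1, SimpleGraph.Adj.reachable ?_⟩
      change (Sum.inl p.1 : U ⊕ S.edgeSet) = Sum.inl p.1
      rfl
  have : Nonempty ((U ⊕ S.edgeSet) ⊕ (Σ v : U, Fin (ℓ v))) :=
    hS.nonempty.map fun v => Sum.inl (Sum.inl v)
  refine ⟨fun x y => ?_⟩
  obtain ⟨v, hv⟩ := hall x
  obtain ⟨w, hw⟩ := hall y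
  exact (hv.trans (hcore v w)).trans hw.symm

/-- Relabelling the tree relabels the subdivision graph with pendant edges. -/
def subdivisionWithPendantsIso {W : Type*} {R : SimpleGraph W} (f : R ≃g S) (ℓ : U → ℕ) :
    subdivisionWithPendants R (ℓ ∘ f) ≃g subdivisionWithPendants S ℓ where
  toEquiv := Equiv.sumCongr (Equiv.sumCongr f.toEquiv f.mapEdgeSet)
    (Equiv.sigmaCongrLeft (β := fun v => Fin (ℓ v)) f.toEquiv)
  map_rel_iff' := by
    have hmem : ∀ (v : W) (e : R.edgeSet), f v ∈ ((f.mapEdgeSet e : S.edgeSet) : Sym2 U) ↔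
        v ∈ (e : Sym2 W) := by
      rintro v ⟨e, he⟩
      change f v ∈ Sym2.map f e ↔ v ∈ e
      rw [Sym2.mem_map]
      exact ⟨fun ⟨w, hw, h⟩ => f.injective h ▸ hw, fun h => ⟨v, h, rfl⟩⟩
    have hinl : ∀ v w : W, (Sum.inl (f v) : U ⊕ S.edgeSet) = Sum.inl (f w) ↔
        (Sum.inl v : W ⊕ R.edgeSet) = Sum.inl w := by
      intro v w
      rw [Sum.inl.injEq, Sum.inl.injEq, f.injective.eq_iff]
    rintro ((v | e) | p) ((w | e') | q)
    · exact Iff.rfl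
    · exact hmem v e'
    · exact hinl v q.1
    · exact hmem w e
    · exact Iff.rfl
    · exact iff_of_false Sum.inr_ne_inl Sum.inr_ne_inl
    · exact hinl w p.1
    · exact iff_of_false Sum.inr_ne_inl Sum.inr_ne_inl
    · exact Iff.rfl

variable [Fintype U]

open Classical in
theorem degree_eq_sum_ite {W : Type*} [Fintype W] (G : SimpleGraph W) (v : W) :
    G.degree v = ∑ w, if G.Adj v w then 1 else 0 := by
  rw [← Finset.card_filter, ← SimpleGraph.card_neighborFinset_eq_degree,
    SimpleGraph.neighborFinset_eq_filter]

open Classical in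
theorem degree_subdivisionWithPendants_core (ℓ : U → ℕ) (v : U) :
    (subdivisionWithPendants S ℓ).degree (.inl (.inl v)) = ℓ v + S.degree v := by
  rw [degree_eq_sum_ite, Fintype.sum_sum_type, Fintype.sum_sum_type, Fintype.sum_sigma]
  have h1 : ∀ w : U, ¬ (subdivisionWithPendants S ℓ).Adj (.inl (.inl v)) (.inl (.inl w)) :=
    fun w h => h
  have h2 : ∀ e : S.edgeSet, (subdivisionWithPendants S ℓ).Adj (.inl (.inl v)) (.inl (.inr e)) ↔
      v ∈ (e : Sym2 U) := fun e => Iff.rfl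
  have h3 : ∀ (w : U) (k : Fin (ℓ w)),
      (subdivisionWithPendants S ℓ).Adj (.inl (.inl v)) (.inr ⟨w, k⟩) ↔ v = w :=
    fun w k => Sum.inl.injEq v w ▸ Iff.rfl
  have h4 : (∑ e : S.edgeSet, if v ∈ (e : Sym2 U) then 1 else 0) = S.degree v := by
    rw [← SimpleGraph.card_incidenceFinset_eq_degree, SimpleGraph.incidenceFinset_eq_filter,
      Finset.card_filter]
    exact (Finset.sum_subtype (p := fun e => e ∈ S.edgeSet) S.edgeFinset
      (fun e => SimpleGraph.mem_edgeFinset) fun e => if v ∈ e then 1 else 0).symm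
  simp only [h1, h2, h3, h4, if_false, Finset.sum_const_zero, zero_add, Finset.sum_const,
    Finset.card_univ, Fintype.card_fin, smul_eq_mul, mul_ite, mul_one, mul_zero]
  rw [Finset.sum_ite_eq, if_pos (Finset.mem_univ v), add_comm]

open Classical in
theorem degree_subdivisionWithPendants_edge (ℓ : U → ℕ) (e : S.edgeSet) :
    (subdivisionWithPendants S ℓ).degree (.inl (.inr e)) ≤ 2 := by
  obtain ⟨e, he⟩ := e
  induction e with
  | _ a b =>
    rw [← SimpleGraph.card_neighborFinset_eq_degree]
    refine le_trans (Finset.card_le_card (t := {.inl (.inl a), .inl (.inl b)}) ?_)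
      Finset.card_le_two
    rintro ((v | e') | p) h
    · rw [SimpleGraph.mem_neighborFinset] at h
      have h : v ∈ s(a, b) := h
      simpa using h
    · rw [SimpleGraph.mem_neighborFinset] at h
      exact h.elim
    · rw [SimpleGraph.mem_neighborFinset] at h
      exact absurd h Sum.inr_ne_inl

open Classical in
theorem degree_subdivisionWithPendants_pendant (ℓ : U → ℕ) (p : Σ v : U, Fin (ℓ v)) :
    (subdivisionWithPendants S ℓ).degree (.inr p) ≤ 1 := by
  rw [← SimpleGraph.card_neighborFinset_eq_degree]
  refine le_trans (Finset.card_le_card (t := {.inl (.inl p.1)}) ?_) (Finset.card_singleton _).le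
  rintro (v | q) h
  · rw [SimpleGraph.mem_neighborFinset] at h
    have h : v = Sum.inl p.1 := h
    simp [h]
  · rw [SimpleGraph.mem_neighborFinset] at h
    exact h.elim

end Subdivision

/-! ### Trees on four vertices. -/

section FourVertices

/-- The adjacency table of a graph on four vertices with prescribed edges. -/
def adjTable (b01 b02 b03 b12 b13 b23 : Bool) : Fin 4 → Fin 4 → Bool :=
  ![![false, b01, b02, b03], ![b01, false, b12, b13], ![b02, b12, false, b23],
    ![b03, b13, b23, false]]

-- Three edges on four vertices form a star, a path or a triangle with an isolated vertex; the last
-- is excluded. Only 64 tables need checking.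
set_option maxRecDepth 100000 in
theorem adjTable_classification : ∀ b01 b02 b03 b12 b13 b23 : Bool,
    b01.toNat + b02.toNat + b03.toNat + b12.toNat + b13.toNat + b23.toNat = 3 →
    (∀ i, ∃ j, adjTable b01 b02 b03 b12 b13 b23 i j = true) →
    (∃ d : Fin 4, ∀ j, j ≠ d → adjTable b01 b02 b03 b12 b13 b23 d j = true) ∨
    ∃ a b c d : Fin 4, a ≠ b ∧ a ≠ c ∧ a ≠ d ∧ b ≠ c ∧ b ≠ d ∧ c ≠ d ∧
      adjTable b01 b02 b03 b12 b13 b23 a b = true ∧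
      adjTable b01 b02 b03 b12 b13 b23 b c = true ∧
      adjTable b01 b02 b03 b12 b13 b23 c d = true := by
  decide

end FourVertices

/-! ### Recognition of subdivided trees with pendant edges. -/

section Structure

variable {V : Type*} [Fintype V] {T : SimpleGraph V} {C : Finset V}

open Classical in
/-- A tree with an independent cover of size four and degrees at most two outside the cover is the
subdivision of a tree on four vertices with pendant edges attached. -/
theorem exists_iso_subdivisionWithPendants (hT : T.IsTree)
    (hC : ∀ i j, T.Adj i j → i ∈ C ∨ j ∈ C) (hcard : C.card = 4)
    (hCC : ∀ u ∈ C, ∀ v ∈ C, ¬ T.Adj u v) (hdeg : ∀ w ∉ C, T.degree w ≤ 2) :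
    ∃ (S : SimpleGraph (Fin 4)) (ℓ : Fin 4 → ℕ), S.Connected ∧ Nat.card S.edgeSet = 3 ∧
      ∑ i, ℓ i + 7 = Fintype.card V ∧ Nonempty (T ≃g subdivisionWithPendants S ℓ) := by
  have hV : 1 < Fintype.card V := by
    have := Finset.card_le_univ C
    omega
  have : Nontrivial V := Fintype.one_lt_card_iff_nontrivial.1 hV
  let c : Fin 4 → V := fun i => ((C.equivFinOfCardEq hcard).symm i : V)
  have hcC : ∀ i, c i ∈ C := fun i => ((C.equivFinOfCardEq hcard).symm i).2
  have hcinj : Function.Injective c :=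
    Subtype.val_injective.comp (C.equivFinOfCardEq hcard).symm.injective
  have hcsurj : ∀ v ∈ C, ∃ i, c i = v := fun v hv =>
    ⟨C.equivFinOfCardEq hcard ⟨v, hv⟩, by simp [c]⟩
  have hnbr : ∀ w ∉ C, ∀ v, T.Adj w v → ∃ i, c i = v := fun w hw v h =>
    hcsurj v ((hC w v h).resolve_left hw)
  -- The tree to be subdivided: core vertices are joined when they have a common neighbour in `T`.
  let S : SimpleGraph (Fin 4) :=
    { Adj := fun i j => i ≠ j ∧ ∃ w, T.Adj w (c i) ∧ T.Adj w (c j)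
      symm := ⟨fun i j h => ⟨h.1.symm, h.2.imp fun w hw => ⟨hw.2, hw.1⟩⟩⟩
      loopless := ⟨fun i h => h.1 rfl⟩ }
  have hS : ∀ i j, S.Adj i j ↔ i ≠ j ∧ ∃ w, T.Adj w (c i) ∧ T.Adj w (c j) := fun i j => Iff.rfl
  have hnotC : ∀ w i, T.Adj w (c i) → w ∉ C := fun w i h hw => hCC w hw _ (hcC i) h
  have hSconn : S.Connected := by
    -- Sending each outer vertex to an adjacent core vertex carries edges of `T` to edges of `S` or
    -- single vertices, so connectedness passes to `S`.
    have hr : ∀ v, ∃ i, c i = v ∨ (v ∉ C ∧ T.Adj v (c i)) := by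
      intro v
      by_cases hv : v ∈ C
      · exact (hcsurj v hv).imp fun i => Or.inl
      · obtain ⟨b, hb⟩ := (T.degree_pos_iff_exists_adj v).1
          (hT.connected.preconnected.degree_pos_of_nontrivial v)
        obtain ⟨i, rfl⟩ := hnbr v hv b hb
        exact ⟨i, Or.inr ⟨hv, hb⟩⟩
    choose r hr using hr
    have hrc : ∀ i, r (c i) = i := fun i =>
      (hr (c i)).elim (fun h => hcinj h) fun h => absurd (hcC i) h.1
    have hstep : ∀ i w, T.Adj (c i) w → S.Reachable i (r w) := by
      intro i w hiw
      have hw := hnotC w i hiw.symm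
      have hw' := (hr w).resolve_left fun h => hw (h ▸ hcC _)
      by_cases hi : i = r w
      · rw [← hi]
      · exact SimpleGraph.Adj.reachable ((hS _ _).2 ⟨hi, w, hiw.symm, hw'.2⟩)
    refine connected_of_adj_reachable hT.connected r (fun i => ⟨c i, hrc i⟩) fun x y hxy => ?_
    rcases hC x y hxy with h | h
    · obtain ⟨i, rfl⟩ := hcsurj x h
      rw [hrc]
      exact hstep i y hxy
    · obtain ⟨i, rfl⟩ := hcsurj y h
      rw [hrc]
      exact (hstep i x hxy.symm).symm
  have hg : ∀ e : S.edgeSet, ∃ w, ∀ i, T.Adj w (c i) ↔ i ∈ (e : Sym2 (Fin 4)) := by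
    rintro ⟨e, he⟩
    induction e with
    | _ i j =>
      obtain ⟨hij, w, hwi, hwj⟩ := (hS i j).1 he
      refine ⟨w, fun k => ⟨fun hk => ?_, fun hk => ?_⟩⟩
      · by_contra hne
        have hne : ¬ (k = i ∨ k = j) := fun h => hne (Sym2.mem_iff.2 h)
        rw [not_or] at hne
        have h3 : ({c i, c j, c k} : Finset V).card = 3 := by
          refine Finset.card_eq_three.2 ⟨_, _, _, hcinj.ne hij, hcinj.ne (Ne.symm hne.1),
            hcinj.ne (Ne.symm hne.2), rfl⟩
        have h4 : ({c i, c j, c k} : Finset V) ⊆ T.neighborFinset w := by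
          intro z hz
          simp only [Finset.mem_insert, Finset.mem_singleton] at hz
          rw [SimpleGraph.mem_neighborFinset]
          rcases hz with rfl | rfl | rfl <;> assumption
        have h5 := Finset.card_le_card h4
        rw [SimpleGraph.card_neighborFinset_eq_degree] at h5
        have := hdeg w (hnotC w i hwi)
        omega
      · rcases Sym2.mem_iff.1 hk with rfl | rfl <;> assumption
  choose g hg using hg
  have hgC : ∀ e, g e ∉ C := by
    rintro ⟨e, he⟩
    induction e with
    | _ i j => exact hnotC _ i ((hg _ i).2 (Sym2.mem_mk_left i j))
  let L : Fin 4 → Finset V := fun i => (outerLeaves T C).filter fun p => T.Adj (c i) p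
  have hL : ∀ i p, p ∈ L i ↔ p ∈ outerLeaves T C ∧ T.Adj (c i) p := fun i p => Finset.mem_filter
  have hLuniq : ∀ i p j, p ∈ L i → T.Adj p (c j) → i = j := by
    intro i p j hp hj
    obtain ⟨b, -, hb⟩ := exists_nbr_of_mem_outerLeaves hC ((hL i p).1 hp).1
    exact hcinj (((hb _).1 ((hL i p).1 hp).2.symm).trans ((hb _).1 hj).symm)
  have hLC : ∀ i p, p ∈ L i → p ∉ C := fun i p hp => (mem_outerLeaves.1 ((hL i p).1 hp).1).1
  let ℓ : Fin 4 → ℕ := fun i => (L i).card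
  let φ : (Fin 4 ⊕ S.edgeSet) ⊕ (Σ i, Fin (ℓ i)) → V :=
    Sum.elim (Sum.elim c g) fun p => ((L p.1).equivFin.symm p.2 : V)
  have hpend : ∀ p : Σ i, Fin (ℓ i), φ (.inr p) ∈ L p.1 :=
    fun p => ((L p.1).equivFin.symm p.2).2
  have hedgepend : ∀ (e : S.edgeSet) (p : Σ i, Fin (ℓ i)), g e ≠ φ (.inr p) := by
    rintro ⟨e, he⟩ p h
    induction e with
    | _ i j =>
      have hi := (hg ⟨s(i, j), he⟩ i).2 (Sym2.mem_mk_left i j)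
      have hj := (hg ⟨s(i, j), he⟩ j).2 (Sym2.mem_mk_right i j)
      rw [h] at hi hj
      exact ((hS i j).1 he).1
        ((hLuniq _ _ _ (hpend p) hi).symm.trans (hLuniq _ _ _ (hpend p) hj))
  have hφinj : Function.Injective φ := by
    rintro ((i | e) | p) ((j | e') | q) h
    · exact congrArg (Sum.inl ∘ Sum.inl) (hcinj h)
    · have h : c i = g e' := h
      exact absurd (h ▸ hcC i) (hgC e')
    · exact absurd (h ▸ hcC i : φ (.inr q) ∈ C) (hLC _ _ (hpend q))
    · have h : g e = c j := h
      exact absurd (h ▸ hcC j) (hgC e)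
    · have h : g e = g e' := h
      refine congrArg (Sum.inl ∘ Sum.inr) (Subtype.ext (Sym2.ext fun i => ?_))
      rw [← hg e, ← hg e', h]
    · exact absurd h (hedgepend e q)
    · exact absurd (h.symm ▸ hcC j : φ (.inr p) ∈ C) (hLC _ _ (hpend p))
    · exact absurd h.symm (hedgepend e' p)
    · have hpq : p.1 = q.1 := by
        refine hLuniq _ _ _ (hpend p) ?_
        rw [h]
        exact ((hL _ _).1 (hpend q)).2.symm
      obtain ⟨i, k⟩ := p
      obtain ⟨j, m⟩ := q
      obtain rfl : i = j := hpq
      have h : (((L i).equivFin.symm k : L i) : V) = ((L i).equivFin.symm m : L i) := h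
      rw [(L i).equivFin.symm.injective (Subtype.ext h)]
  have hcardφ : Fintype.card ((Fin 4 ⊕ S.edgeSet) ⊕ (Σ i, Fin (ℓ i))) =
      4 + Nat.card S.edgeSet + ∑ i, ℓ i := by
    rw [Fintype.card_sum, Fintype.card_sum, Fintype.card_fin, Fintype.card_sigma,
      Nat.card_eq_fintype_card]
    simp only [Fintype.card_fin]
  have hle := Fintype.card_le_of_injective φ hφinj
  have hedges := hSconn.card_vert_le_card_edgeSet_add_one
  have hleaves : (outerLeaves T C).card ≤ ∑ i, ℓ i := by
    refine le_trans (Finset.card_le_card fun p hp => ?_)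
      (Finset.card_biUnion_le (s := Finset.univ) (t := L))
    obtain ⟨b, hb, hb'⟩ := exists_nbr_of_mem_outerLeaves hC hp
    obtain ⟨i, rfl⟩ := hcsurj b hb
    exact Finset.mem_biUnion.2
      ⟨i, Finset.mem_univ i, (hL i p).2 ⟨hp, ((hb' _).2 rfl).symm⟩⟩
  have h1 := two_mul_card_compl_le hT.connected C
  have h2 := sum_degree_compl_le hC
  have h3 := hT.card_edgeFinset
  rw [Finset.card_compl, hcard] at h1
  rw [Nat.card_fin] at hedges
  rw [hcardφ] at hle
  -- Injectivity gives 4 + |E(S)| + ∑ ℓ ≤ n, while connectedness of `S` gives |E(S)| ≥ 3 and the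
  -- leaf count gives ∑ ℓ ≥ n-7. So equality holds throughout.
  have hbij : Function.Bijective φ := by
    rw [Fintype.bijective_iff_injective_and_card, hcardφ]
    exact ⟨hφinj, by omega⟩
  refine ⟨S, ℓ, hSconn, by omega, by omega, ⟨RelIso.symm ⟨Equiv.ofBijective φ hbij, ?_⟩⟩⟩
  intro x y
  have hpadj : ∀ i (p : Σ i, Fin (ℓ i)), T.Adj (c i) (φ (.inr p)) ↔
      (Sum.inl i : Fin 4 ⊕ S.edgeSet) = Sum.inl p.1 := by
    intro i p
    rw [Sum.inl.injEq]
    constructor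
    · exact fun h => (hLuniq _ _ _ (hpend p) h.symm).symm
    · rintro rfl
      exact ((hL _ _).1 (hpend p)).2
  have hII : ∀ a b, a ∉ C → b ∉ C → ¬ T.Adj a b := fun a b ha hb h => (hC a b h).elim ha hb
  rcases x with (i | e) | p <;> rcases y with (j | e') | q
  · exact iff_of_false (hCC _ (hcC i) _ (hcC j)) id
  · exact (T.adj_comm _ _).trans (hg e' i)
  · exact hpadj i q
  · exact hg e j
  · exact iff_of_false (hII _ _ (hgC e) (hgC e')) id
  · exact iff_of_false (hII _ _ (hgC e) (hLC _ _ (hpend q))) Sum.inr_ne_inl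
  · exact (T.adj_comm _ _).trans (hpadj j p)
  · exact iff_of_false (hII _ _ (hLC _ _ (hpend p)) (hgC e')) Sum.inr_ne_inl
  · exact iff_of_false (hII _ _ (hLC _ _ (hpend p)) (hLC _ _ (hpend q))) id

open Classical in
theorem card_edgeSet_pathGraph_four : Nat.card (SimpleGraph.pathGraph 4).edgeSet = 3 := by
  rw [Nat.card_eq_fintype_card, ← SimpleGraph.edgeFinset_card]
  have := (SimpleGraph.pathGraph 4).sum_degrees_eq_twice_card_edges
  simp only [degree_eq_sum_ite, Fin.sum_univ_four, SimpleGraph.pathGraph_adj] at this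
  norm_num at this
  omega

open Classical in
theorem iso_starK13_or_pathGraph {S : SimpleGraph (Fin 4)} (hS : S.Connected)
    (hcard : Nat.card S.edgeSet = 3) :
    Nonempty (starK13 ≃g S) ∨ Nonempty (SimpleGraph.pathGraph 4 ≃g S) := by
  have htab : ∀ i j, adjTable (decide (S.Adj 0 1)) (decide (S.Adj 0 2)) (decide (S.Adj 0 3))
      (decide (S.Adj 1 2)) (decide (S.Adj 1 3)) (decide (S.Adj 2 3)) i j = true ↔ S.Adj i j := by
    intro i j
    fin_cases i <;> fin_cases j <;>
      simp [adjTable, S.adj_comm 1 0, S.adj_comm 2 0, S.adj_comm 3 0, S.adj_comm 2 1,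
        S.adj_comm 3 1, S.adj_comm 3 2]
  have hsum : (decide (S.Adj 0 1)).toNat + (decide (S.Adj 0 2)).toNat +
      (decide (S.Adj 0 3)).toNat + (decide (S.Adj 1 2)).toNat + (decide (S.Adj 1 3)).toNat +
      (decide (S.Adj 2 3)).toNat = 3 := by
    have h := S.sum_degrees_eq_twice_card_edges
    rw [Nat.card_eq_fintype_card, ← SimpleGraph.edgeFinset_card] at hcard
    simp only [hcard, degree_eq_sum_ite, Fin.sum_univ_four, SimpleGraph.irrefl, if_false,
      S.adj_comm 1 0, S.adj_comm 2 0, S.adj_comm 3 0, S.adj_comm 2 1, S.adj_comm 3 1,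
      S.adj_comm 3 2] at h
    simp only [Bool.toNat, Bool.cond_decide]
    omega
  have hdeg : ∀ i, ∃ j, S.Adj i j := fun i =>
    (S.degree_pos_iff_exists_adj i).1 (hS.preconnected.degree_pos_of_nontrivial i)
  -- An injective homomorphism between graphs on four vertices with three edges each is an
  -- isomorphism, so finding a star or path inside `S` suffices.
  have hmk : ∀ (R : SimpleGraph (Fin 4)) (f : Fin 4 → Fin 4), Function.Injective f →
      Nat.card R.edgeSet = 3 → (∀ i j, R.Adj i j → S.Adj (f i) (f j)) → Nonempty (R ≃g S) := by
    intro R f hf hR hRS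
    let e := Equiv.ofBijective f (Finite.injective_iff_bijective.1 hf)
    have hle : R.map e.toEmbedding ≤ S := by
      rw [SimpleGraph.map_le_iff_le_comap]
      exact fun i j h => hRS i j h
    have hcard' : Nat.card (R.map e.toEmbedding).edgeSet = 3 := by
      rw [← hR]
      exact (Nat.card_congr (SimpleGraph.Iso.map e R).mapEdgeSet).symm
    have heq : R.map e.toEmbedding = S := by
      rw [← SimpleGraph.edgeSet_inj]
      exact Set.eq_of_subset_of_ncard_le (SimpleGraph.edgeSet_subset_edgeSet.2 hle)
        (hcard.trans hcard'.symm).le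
    exact ⟨heq ▸ SimpleGraph.Iso.map e R⟩
  rcases adjTable_classification _ _ _ _ _ _ hsum (fun i => (hdeg i).imp fun j => (htab i j).2)
    with ⟨d, hd⟩ | ⟨a, b, c, d, hab, hac, had, hbc, hbd, hcd, h1, h2, h3⟩
  · left
    refine hmk starK13 (Equiv.swap 3 d) (Equiv.injective _) ?_ fun i j hij => ?_
    · have := (SimpleGraph.isTree_iff_connected_and_card.1
        (SimpleGraph.isTree_starGraph (3 : Fin 4))).2
      rw [Nat.card_fin] at this
      exact Nat.succ.inj this
    · have hd' : ∀ j, j ≠ d → S.Adj d j := fun j hj => (htab d j).1 (hd j hj)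
      rw [starK13, SimpleGraph.starGraph_adj] at hij
      rcases hij with ⟨hne, rfl | rfl⟩
      · rw [Equiv.swap_apply_left]
        exact hd' _ fun h => hne (by simpa using (Equiv.swap_apply_eq_iff.1 h).symm)
      · rw [Equiv.swap_apply_left]
        exact (hd' _ fun h => hne (by simpa using (Equiv.swap_apply_eq_iff.1 h))).symm
  · right
    refine hmk (SimpleGraph.pathGraph 4) ![a, b, c, d] ?_ card_edgeSet_pathGraph_four
      fun i j hij => ?_
    · intro i j hij
      fin_cases i <;> fin_cases j <;> simp_all
    · rw [htab] at h1 h2 h3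
      have hstep : ∀ i j : Fin 4, i.val + 1 = j.val →
          S.Adj ((![a, b, c, d] : Fin 4 → Fin 4) i) ((![a, b, c, d] : Fin 4 → Fin 4) j) := by
        intro i j h
        fin_cases i <;> fin_cases j <;>
          first | exact h1 | exact h2 | exact h3 | exact absurd h (by decide)
      rcases SimpleGraph.pathGraph_adj.1 hij with h | h
      · exact hstep i j h
      · exact (hstep j i h).symm

end Structure

/-! ### The balanced competitor and the shape of minimizers. -/

section Minimizer

variable {V : Type*} [Fintype V] {T : SimpleGraph V} {σ : ℝ}

open Classical in
/-- A balanced graph of the path family beats every connected graph with a vertex of larger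
degree. -/
theorem exists_balanced_graph (hσ : 1 / 2 ≤ σ) (hσ1 : σ < 1) (hn : 12 ≤ Fintype.card V) {D : ℕ}
    (hD : D = (Fintype.card V + 2) / 4) :
    ∃ H ∈ connectedWithIndepNum V (Fintype.card V - 4),
      ∀ G : SimpleGraph V, G.Connected → (∃ v, D < G.degree v) →
        aSigmaIndex σ H < aSigmaIndex σ G := by
  obtain ⟨S, hSpath⟩ : ∃ S, S = SimpleGraph.pathGraph 4 := ⟨_, rfl⟩
  -- Three core vertices get degree exactly D and the last one the remainder n-1-3D, which is at
  -- most D because n-1 ≤ 4D.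
  let ℓ : Fin 4 → ℕ := ![D - 1, D - 2, D - 2, Fintype.card V - 2 - 3 * D]
  have hSdeg : ∀ i, ℓ i + S.degree i ≤ D := by
    intro i
    rw [degree_eq_sum_ite, Fin.sum_univ_four]
    simp only [hSpath, SimpleGraph.pathGraph_adj]
    fin_cases i <;> norm_num [ℓ] <;> omega
  have hSconn : S.Connected := hSpath ▸ SimpleGraph.pathGraph_connected 3
  have hScard : Nat.card S.edgeSet = 3 := hSpath ▸ card_edgeSet_pathGraph_four
  have hcard : Fintype.card V = Fintype.card ((Fin 4 ⊕ S.edgeSet) ⊕ (Σ i, Fin (ℓ i))) := by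
    rw [Fintype.card_sum, Fintype.card_sum, Fintype.card_fin, Fintype.card_sigma,
      ← Nat.card_eq_fintype_card (α := S.edgeSet), hScard]
    simp only [Fintype.card_fin, Fin.sum_univ_four, ℓ]
    simp
    omega
  obtain ⟨H, ⟨f⟩⟩ : ∃ H : SimpleGraph V, Nonempty (H ≃g subdivisionWithPendants S ℓ) :=
    ⟨_, ⟨SimpleGraph.Iso.comap (Fintype.equivOfCardEq hcard) _⟩⟩
  let C : Finset V := Finset.univ.image fun i : Fin 4 => f.symm (.inl (.inl i))
  have hCmem : ∀ v, v ∈ C ↔ ∃ i, f v = .inl (.inl i) := by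
    intro v
    simp only [C, Finset.mem_image, Finset.mem_univ, true_and]
    refine exists_congr fun i => ?_
    rw [← f.injective.eq_iff, RelIso.apply_symm_apply, eq_comm]
  have hCcard : C.card ≤ 4 := Finset.card_image_le.trans (by simp)
  have hconn : H.Connected := f.connected_iff.2 (subdivisionWithPendants_connected hSconn ℓ)
  have hdegf : ∀ v, H.degree v = (subdivisionWithPendants S ℓ).degree (f v) := fun v =>
    (f.degree_eq v).symm
  have hdegC : ∀ v ∈ C, H.degree v ≤ D := by
    intro v hv
    obtain ⟨i, hi⟩ := (hCmem v).1 hv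
    rw [hdegf, hi, degree_subdivisionWithPendants_core]
    exact hSdeg i
  have hdegI : ∀ v ∉ C, H.degree v ≤ 2 := by
    intro v hv
    rw [hCmem] at hv
    rw [hdegf]
    rcases h : f v with (i | x) | p
    · exact absurd ⟨i, h⟩ hv
    · exact degree_subdivisionWithPendants_edge ℓ x
    · exact (degree_subdivisionWithPendants_pendant ℓ p).trans one_le_two
  have hbip : ∀ i j, H.Adj i j → (i ∈ (C : Set V) ↔ j ∉ (C : Set V)) := by
    intro i j hij
    have hij : (subdivisionWithPendants S ℓ).Adj (f i) (f j) := f.map_adj_iff.2 hij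
    rw [Finset.mem_coe, Finset.mem_coe, hCmem, hCmem]
    rcases hi : f i with (a | a) | a <;> rcases hj : f j with (b | b) | b <;>
      rw [hi, hj] at hij
    · exact hij.elim
    · simp
    · simp
    · simp
    · exact hij.elim
    · exact absurd hij Sum.inr_ne_inl
    · simp
    · exact absurd hij Sum.inr_ne_inl
    · exact hij.elim
  have hcov : ∀ i j, H.Adj i j → i ∈ C ∨ j ∈ C := by
    intro i j hij
    by_contra! h
    exact h.1 ((hbip i j hij).2 h.2)
  refine ⟨H, ⟨hconn, ?_⟩, fun G hG ⟨v, hv⟩ => ?_⟩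
  · have h1 := card_le_indepNum_add hcov
    -- A larger independence number would leave a cover by three vertices and so force a degree
    -- above D.
    by_contra hne
    obtain ⟨v, hv⟩ := exists_lt_degree_of_indepNum (k := 3) (D := D) hconn (by omega) (by omega)
    by_cases hvC : v ∈ C
    · exact absurd (hdegC v hvC) (by omega)
    · have := hdegI v hvC
      omega
  · obtain ⟨h2, h3⟩ := semiregular_le_of_lt_degree hσ hσ1 hG (by omega) hv
    have hℓ : 0 < ℓ 0 := by
      simp only [ℓ, Matrix.cons_val_zero]
      omega
    refine aSigmaIndex_lt_semiregular (by linarith) hσ1 hconn hbip hdegC hdegI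
      (p := f.symm (.inr ⟨0, ⟨0, hℓ⟩⟩)) ?_ ?_ h2 h3
    · rw [Finset.mem_coe, hCmem]
      simp
    · rw [hdegf, RelIso.apply_symm_apply]
      exact degree_subdivisionWithPendants_pendant ℓ _

open Classical in
/-- The shape of the `A_σ`-minimizers. -/
theorem exists_iso_of_isASigmaMinimizer (hσ : 1 / 2 ≤ σ) (hσ1 : σ < 1)
    (hn : 12 ≤ Fintype.card V) (hT : IsASigmaMinimizer σ (Fintype.card V - 4) T) :
    ∃ (S : SimpleGraph (Fin 4)) (ℓ : Fin 4 → ℕ), (S = starK13 ∨ S = SimpleGraph.pathGraph 4) ∧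
      ∑ i, ℓ i = Fintype.card V - 7 ∧
      (∀ i, ℓ i + S.degree i ≤ (Fintype.card V + 2) / 4) ∧
      Nonempty (T ≃g subdivisionWithPendants S ℓ) := by
  have hσ0 : 0 ≤ σ := by linarith
  obtain ⟨⟨hconn, hind⟩, hmin⟩ := hT
  obtain ⟨H, hH, hHlt⟩ := exists_balanced_graph (V := V) hσ hσ1 hn rfl
  have hdeg : ∀ v, T.degree v ≤ (Fintype.card V + 2) / 4 := by
    by_contra! h
    exact (hHlt T hconn h).not_ge (hmin H hH)
  obtain ⟨C, hCcard, hC⟩ := exists_cover T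
  have hC4 : C.card = 4 := by omega
  -- Minimality extends beyond the family: removing edges may raise the independence number, but
  -- then a degree exceeds D and the graph loses to `H`.
  have hmin' : ∀ G : SimpleGraph V, G.Connected → (∀ i j, G.Adj i j → i ∈ C ∨ j ∈ C) →
      aSigmaIndex σ T ≤ aSigmaIndex σ G := by
    intro G hG hGC
    have h1 := card_le_indepNum_add hGC
    by_cases h : G.indepNum = Fintype.card V - 4
    · exact hmin G ⟨hG, h⟩
    · exact (hmin H hH).trans (hHlt G hG
        (exists_lt_degree_of_indepNum (k := 3) hG (by omega) (by omega))).le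
  have htree : T.IsTree := by
    obtain ⟨R, hRT, hR⟩ := hconn.exists_isTree_le
    rcases hRT.eq_or_lt with rfl | hlt
    · exact hR
    · exact absurd (hmin' R hR.connected fun i j hij => hC i j (hRT hij))
        (aSigmaIndex_lt_of_lt hσ0 hσ1 hR.connected hlt).not_ge
  obtain ⟨S, ℓ, hS, hScard, hsum, ⟨φ⟩⟩ := exists_iso_subdivisionWithPendants htree hC hC4
    (not_adj_of_minimal hσ0 hσ1 hn htree hC hC4 (by omega) hdeg hmin')
    (fun w hw => degree_le_two_of_minimal hσ0 hσ1 hn htree hC hC4 (by omega) hdeg hmin' hw)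
  have hfinish : ∀ R : SimpleGraph (Fin 4), (R = starK13 ∨ R = SimpleGraph.pathGraph 4) →
      Nonempty (R ≃g S) → ∃ (S : SimpleGraph (Fin 4)) (ℓ : Fin 4 → ℕ),
      (S = starK13 ∨ S = SimpleGraph.pathGraph 4) ∧ ∑ i, ℓ i = Fintype.card V - 7 ∧
      (∀ i, ℓ i + S.degree i ≤ (Fintype.card V + 2) / 4) ∧
      Nonempty (T ≃g subdivisionWithPendants S ℓ) := by
    rintro R hR ⟨f⟩
    have ψ : T ≃g subdivisionWithPendants R (ℓ ∘ f) :=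
      φ.trans (subdivisionWithPendantsIso f ℓ).symm
    refine ⟨R, ℓ ∘ f, hR, ?_, fun i => ?_, ⟨ψ⟩⟩
    · have := Equiv.sum_comp f.toEquiv ℓ
      have h : ∑ i, (ℓ ∘ f) i = ∑ i, ℓ i := this
      omega
    · rw [← degree_subdivisionWithPendants_core, ← ψ.symm.degree_eq]
      exact hdeg _
  rcases iso_starK13_or_pathGraph hS hScard with h | h
  · exact hfinish _ (Or.inl rfl) h
  · exact hfinish _ (Or.inr rfl) h

end Minimizer

/-! ### Enumeration of the pendant distributions. -/

section Tables

/-- Here D = t + 2 + r/3, and x, y, z are the slacks of the three leaf vertices below D. The total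
slack 2 - r + 4(r/3) is at most 3, so few cases remain. -/
theorem mem_starTable {t a b c d : ℕ} {r : ℕ} (hr : r < 4) (hab : a ≤ b) (hbc : b ≤ c)
    (hsum : a + b + c + d = 4 * t + r) (hc : c + 1 ≤ t + 2 + r / 3) (hd : d + 3 ≤ t + 2 + r / 3) :
    (fun i => ((![a, b, c, d] : Fin 4 → ℕ) i : ℤ)) ∈ starTable t r := by
  have hvec : ∀ x y z w : ℤ, (a : ℤ) = x → (b : ℤ) = y → (c : ℤ) = z → (d : ℤ) = w →
      (fun i => ((![a, b, c, d] : Fin 4 → ℕ) i : ℤ)) = ![x, y, z, w] := by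
    rintro _ _ _ _ rfl rfl rfl rfl
    ext i
    fin_cases i <;> rfl
  have hx : ∃ x y z : ℕ, a + x = t + 1 + r / 3 ∧ b + y = t + 1 + r / 3 ∧ c + z = t + 1 + r / 3 ∧
      x ≤ 3 ∧ y ≤ x ∧ z ≤ y :=
    ⟨t + 1 + r / 3 - a, t + 1 + r / 3 - b, t + 1 + r / 3 - c, by omega, by omega, by omega,
      by omega, by omega, by omega⟩
  obtain ⟨x, y, z, hx, hy, hz, h1, h2, h3⟩ := hx
  interval_cases r <;> interval_cases x <;> interval_cases y <;> interval_cases z <;>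
    first
    | omega
    | repeat first
        | exact Or.inl (hvec _ _ _ _ (by omega) (by omega) (by omega) (by omega))
        | exact hvec _ _ _ _ (by omega) (by omega) (by omega) (by omega)
        | apply Or.inr

/-- The same total slack is shared, with capacity D-1 at the ends and D-2 at the inner vertices. The
order conditions select one representative under reversal. -/
theorem mem_pathTable {t a b c d : ℕ} {r : ℕ} (hr : r < 4) (had : a ≤ d)
    (hbc : a = d → b ≤ c) (hsum : a + b + c + d = 4 * t + r) (hb : b + 2 ≤ t + 2 + r / 3)
    (hc : c + 2 ≤ t + 2 + r / 3) (hd : d + 1 ≤ t + 2 + r / 3) :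
    (fun i => ((![a, b, c, d] : Fin 4 → ℕ) i : ℤ)) ∈ pathTable t r := by
  have hvec : ∀ x y z w : ℤ, (a : ℤ) = x → (b : ℤ) = y → (c : ℤ) = z → (d : ℤ) = w →
      (fun i => ((![a, b, c, d] : Fin 4 → ℕ) i : ℤ)) = ![x, y, z, w] := by
    rintro _ _ _ _ rfl rfl rfl rfl
    ext i
    fin_cases i <;> rfl
  have hx : ∃ x y z : ℕ, a + x = t + 1 + r / 3 ∧ b + y = t + r / 3 ∧ c + z = t + r / 3 ∧
      x ≤ 3 ∧ y ≤ 3 - x ∧ z ≤ 3 - x - y :=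
    ⟨t + 1 + r / 3 - a, t + r / 3 - b, t + r / 3 - c, by omega, by omega, by omega,
      by omega, by omega, by omega⟩
  obtain ⟨x, y, z, hx, hy, hz, h1, h2, h3⟩ := hx
  interval_cases r <;> interval_cases x <;> interval_cases y <;> interval_cases z <;>
    first
    | omega
    | repeat first
        | exact Or.inl (hvec _ _ _ _ (by omega) (by omega) (by omega) (by omega))
        | exact hvec _ _ _ _ (by omega) (by omega) (by omega) (by omega)
        | apply Or.inr

/-- The automorphisms of the star sort the numbers of pendant edges at the leaves. -/
theorem exists_starK13_iso_sorted (ℓ : Fin 4 → ℕ) :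
    ∃ f : starK13 ≃g starK13, f 3 = 3 ∧ ℓ (f 0) ≤ ℓ (f 1) ∧ ℓ (f 1) ≤ ℓ (f 2) := by
  have hmk : ∀ e : Equiv.Perm (Fin 4), e 3 = 3 → ∃ f : starK13 ≃g starK13, ∀ i, f i = e i := by
    intro e he
    refine ⟨⟨e, ?_⟩, fun i => rfl⟩
    intro i j
    have h : ∀ k, e k = 3 ↔ k = 3 := fun k => by rw [← he, e.injective.eq_iff, he]
    rw [starK13, SimpleGraph.starGraph_adj, SimpleGraph.starGraph_adj, e.injective.ne_iff, h, h]
  have hperm : ∀ e : Equiv.Perm (Fin 4), e 3 = 3 → ℓ (e 0) ≤ ℓ (e 1) → ℓ (e 1) ≤ ℓ (e 2) →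
      ∃ f : starK13 ≃g starK13, f 3 = 3 ∧ ℓ (f 0) ≤ ℓ (f 1) ∧ ℓ (f 1) ≤ ℓ (f 2) := by
    intro e he h1 h2
    obtain ⟨f, hf⟩ := hmk e he
    refine ⟨f, ?_, ?_, ?_⟩ <;> simpa only [hf]
  rcases le_total (ℓ 0) (ℓ 1) with h01 | h01 <;> rcases le_total (ℓ 1) (ℓ 2) with h12 | h12 <;>
    rcases le_total (ℓ 0) (ℓ 2) with h02 | h02
  · exact hperm 1 rfl h01 h12
  · exact hperm 1 rfl h01 h12
  · exact hperm (Equiv.swap 1 2) rfl h02 h12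
  · exact hperm (Equiv.swap 0 1 * Equiv.swap 0 2) rfl h02 h01
  · exact hperm (Equiv.swap 0 1) rfl h01 h02
  · exact hperm (Equiv.swap 0 2 * Equiv.swap 0 1) rfl h12 h02
  · exact hperm (Equiv.swap 0 2) rfl h12 h01
  · exact hperm (Equiv.swap 0 2) rfl h12 h01

/-- Up to reversal of the path, the numbers of pendant edges are ordered. -/
theorem exists_pathGraph_iso_ordered (ℓ : Fin 4 → ℕ) :
    ∃ f : SimpleGraph.pathGraph 4 ≃g SimpleGraph.pathGraph 4,
      ((∀ i, f i = i) ∨ ∀ i, f i = i.rev) ∧ ℓ (f 0) ≤ ℓ (f 3) ∧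
      (ℓ (f 0) = ℓ (f 3) → ℓ (f 1) ≤ ℓ (f 2)) := by
  let g : SimpleGraph.pathGraph 4 ≃g SimpleGraph.pathGraph 4 :=
    { toEquiv := Fin.revPerm
      map_rel_iff' := by
        intro i j
        simp only [SimpleGraph.pathGraph_adj, Fin.revPerm_apply, Fin.val_rev]
        omega }
  by_cases h : ℓ 0 < ℓ 3 ∨ (ℓ 0 = ℓ 3 ∧ ℓ 1 ≤ ℓ 2)
  · refine ⟨SimpleGraph.Iso.refl, Or.inl fun i => rfl, ?_⟩
    change ℓ 0 ≤ ℓ 3 ∧ (ℓ 0 = ℓ 3 → ℓ 1 ≤ ℓ 2)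
    omega
  · refine ⟨g, Or.inr fun i => rfl, ?_⟩
    change ℓ 3 ≤ ℓ 0 ∧ (ℓ 3 = ℓ 0 → ℓ 2 ≤ ℓ 1)
    omega

end Tables

theorem theorem5p1 {V : Type*} [Fintype V] (n : ℕ) (hn : 12 ≤ n) (hV : Fintype.card V = n)
    (σ : ℝ) (hσ : σ ∈ Set.Ico (1 / 2 : ℝ) 1) (T : SimpleGraph V)
    (hT : IsASigmaMinimizer σ (n - 4) T) :
    ∃ t ℓ' : ℕ, t = (n - 7) / 4 ∧ ℓ' = (n - 7) - 4 * t ∧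
      ((∃ ℓ : Fin 4 → ℕ, ∑ i, ℓ i = n - 7 ∧
          (fun i => (ℓ i : ℤ)) ∈ starTable t ℓ' ∧
          Nonempty (T ≃g subdivisionWithPendants starK13 ℓ)) ∨
        (∃ ℓ : Fin 4 → ℕ, ∑ i, ℓ i = n - 7 ∧
          (fun i => (ℓ i : ℤ)) ∈ pathTable t ℓ' ∧
          Nonempty (T ≃g subdivisionWithPendants (SimpleGraph.pathGraph 4) ℓ))) := by
  classical
  subst hV
  obtain ⟨S, ℓ, hS, hsum, hdeg, ⟨φ⟩⟩ := exists_iso_of_isASigmaMinimizer hσ.1 hσ.2 hn hT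
  obtain ⟨t, ht⟩ : ∃ t, t = (Fintype.card V - 7) / 4 := ⟨_, rfl⟩
  obtain ⟨r, hr⟩ : ∃ r, r = Fintype.card V - 7 - 4 * t := ⟨_, rfl⟩
  have hvec : ∀ m : Fin 4 → ℕ, m = ![m 0, m 1, m 2, m 3] := fun m => by
    ext i
    fin_cases i <;> rfl
  refine ⟨t, r, ht, hr, ?_⟩
  -- For r < 4 the natural quotient r/3 is 1 exactly when r = 3, the one residue for which the
  -- degree bound rises.
  have hD : (Fintype.card V + 2) / 4 = t + 2 + r / 3 := by omega
  rw [hD] at hdeg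
  rcases hS with rfl | rfl
  · left
    obtain ⟨f, hf3, h01, h12⟩ := exists_starK13_iso_sorted ℓ
    have hsum' : ∑ i, (ℓ ∘ f) i = Fintype.card V - 7 :=
      (Equiv.sum_comp f.toEquiv ℓ).trans hsum
    have hdeg' : ∀ i, (ℓ ∘ f) i + starK13.degree i ≤ t + 2 + r / 3 := fun i => by
      rw [← f.degree_eq i]
      exact hdeg (f i)
    refine ⟨ℓ ∘ f, hsum', ?_, ⟨φ.trans (subdivisionWithPendantsIso f ℓ).symm⟩⟩
    have hstar : ∀ i, starK13.degree i =
        ∑ j, if i ≠ j ∧ (i = 3 ∨ j = 3) then 1 else 0 := fun i => by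
      rw [degree_eq_sum_ite]
      simp only [starK13, SimpleGraph.starGraph_adj]
    have h2 := hdeg' 2
    have h3 := hdeg' 3
    simp only [hstar, Fin.sum_univ_four] at h2 h3
    norm_num at h2 h3
    rw [Fin.sum_univ_four] at hsum'
    rw [hvec (ℓ ∘ f)]
    exact mem_starTable (by omega) h01 h12 (by omega) h2 h3
  · right
    obtain ⟨f, -, h03, h12⟩ := exists_pathGraph_iso_ordered ℓ
    have hsum' : ∑ i, (ℓ ∘ f) i = Fintype.card V - 7 :=
      (Equiv.sum_comp f.toEquiv ℓ).trans hsum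
    have hdeg' : ∀ i, (ℓ ∘ f) i + (SimpleGraph.pathGraph 4).degree i ≤ t + 2 + r / 3 := fun i => by
      rw [← f.degree_eq i]
      exact hdeg (f i)
    refine ⟨ℓ ∘ f, hsum', ?_, ⟨φ.trans (subdivisionWithPendantsIso f ℓ).symm⟩⟩
    have h1 := hdeg' 1
    have h2 := hdeg' 2
    have h3 := hdeg' 3
    simp only [degree_eq_sum_ite, Fin.sum_univ_four, SimpleGraph.pathGraph_adj] at h1 h2 h3
    norm_num at h1 h2 h3
    rw [Fin.sum_univ_four] at hsum'
    rw [hvec (ℓ ∘ f)]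
    exact mem_pathTable (by omega) h03 h12 (by omega) h1 h2 h3
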